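/- **Theorem (the Hurewicz morphism is an isomorphism).** Let $k$ be a field and let $\mathcal C$ be a small $k$-linear category which is Schurian, that is, every space of morphisms ${}_y\mathcal C_x$ (from $x$ to $y$) has dimension $0$ or $1$, and connected, that is, any two objects are joined by a walk (a finite sequence of composable non-zero morphisms and formal reverses of non-zero morphisms). Choose a non-zero morphism ${}_ye_x$ in each non-zero space ${}_y\mathcal C_x$, with ${}_xe_x$ the identity of $x$. Let $CW(\mathcal C)$ be the $2$-dimensional CW-complex whose $0$-cells are the objects of $\mathcal C$, with a $1$-cell from $x$ to $y$ for each ${}_ye_x$ with $x\neq y$, and with a $2$-cell for each triple $(x,y,z)$ of objects such that $x\ne y$, $y\neq z$ and ${}_ze_y\,{}_ye_x\neq 0$, attached so that the path along ${}_ye_x$ followed by ${}_ze_y$ becomes homotopic to the path along ${}_ze_x$ (to the constant path at $x$ if $z=x$). Each walk in $\mathcal C$ describes a path in $CW(\mathcal C)$, identities giving constant paths. Let $c_0$ be an object and, for each object $x$, let $u_x$ be a walk from $c_0$ to $x$. Let $U$ be the corresponding universal grading of $\mathcal C$ by the group $\pi_1(CW(\mathcal C),c_0)$: every non-zero morphism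 $f\in{}_y\mathcal C_x$ is homogeneous, of degree $\deg f=[u_y^{-1}\;{}_ye_x\;u_x]$ (the class of the loop that runs along $u_x$, then ${}_ye_x$, then $u_y$ backwards). Let $HH^1(\mathcal C)$ be the first Hochschild–Mitchell cohomology: the vector space of $k$-derivations of $\mathcal C$ (families of linear maps ${}_yd_x:{}_y\mathcal C_x\to{}_y\mathcal C_x$ with $d(gf)=d(g)f+g\,d(f)$), modulo the inner derivations $f\mapsto a_yf-fa_x$ for $f \in {}_y\mathcal C_x$, where $a=(a_x)_x$ is a family of endomorphisms $a_x\in{}_x\mathcal C_x$. Then the Hurewicz morphism $$h:\operatorname{Hom}(\pi_1(CW(\mathcal C),c_0),k^+)\longrightarrow HH^1(\mathcal C),$$ which sends a character $\chi$ to the class of the Eulerian derivation $f\mapsto\chi(\deg f)\,f$ ($f$ non-zero, hence homogeneous), is an isomorphism of $k$-vector spaces. -/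

import Mathlib

open CategoryTheory

universe u v w

noncomputable section

/-! ### Linear categories, walks, gradings -/

section Linear

variable (k : Type w) [Field k] (C : Type u) [Category.{v} C] [Preadditive C] [Linear k C]

/-- A `k`-category is Schurian if every space of morphisms has dimension zero or one. -/
def IsSchurian : Prop :=
  ∀ x y : C, Module.rank k (x ⟶ y) = 0 ∨ Module.rank k (x ⟶ y) = 1

/-- A grading of a `k`-category by a group `Γ`: a direct sum decomposition of every space of
morphisms, compatible with composition.  The degree of "`f` followed by `g`", that is of `g f`,
is `(deg g) (deg f)`. -/
structure CatGrading (Γ : Type*) [Group Γ] where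
  comp : Γ → ∀ x y : C, Submodule k (x ⟶ y)
  isInternal : ∀ x y : C, letI := Classical.decEq Γ
    DirectSum.IsInternal (fun s : Γ => comp s x y)
  comp_mem : ∀ {x y z : C} {s t : Γ} {f : x ⟶ y} {g : y ⟶ z},
    f ∈ comp s x y → g ∈ comp t y z → f ≫ g ∈ comp (t * s) x z

/-- The vector space of derivations of a `k`-category: families of `k`-linear endomorphisms of the
spaces of morphisms satisfying `d (g f) = d (g) f + g d (f)`. -/
def catDerivations : Submodule k (∀ x y : C, (x ⟶ y) →ₗ[k] (x ⟶ y)) where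
  carrier := {d | ∀ (x y z : C) (f : x ⟶ y) (g : y ⟶ z),
    d x z (f ≫ g) = f ≫ d y z g + d x y f ≫ g}
  zero_mem' := by intro x y z f g; simp
  add_mem' := by
    intro d d' h h' x y z f g
    simp only [Pi.add_apply, LinearMap.add_apply, h x y z f g, h' x y z f g,
      Preadditive.comp_add, Preadditive.add_comp]
    abel
  smul_mem' := by
    intro c d h x y z f g
    simp only [Pi.smul_apply, LinearMap.smul_apply, h x y z f g, smul_add,
      Linear.comp_smul, Linear.smul_comp]

/-- The inner derivation attached to a family `a` of endomorphisms, `f ↦ a_y f - f a_x`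
for `f : x ⟶ y`; it depends linearly on `a`. -/
def innerDerivation : (∀ x : C, x ⟶ x) →ₗ[k] catDerivations k C where
  toFun a := ⟨fun x y =>
    { toFun := fun f => f ≫ a y - a x ≫ f
      map_add' := by
        intro f g
        simp only [Preadditive.comp_add, Preadditive.add_comp]
        abel
      map_smul' := by
        intro c f
        simp only [Linear.comp_smul, Linear.smul_comp, smul_sub, RingHom.id_apply] }, by
    intro x y z f g
    simp only [LinearMap.coe_mk, AddHom.coe_mk, Preadditive.comp_sub, Preadditive.sub_comp,
      Category.assoc]
    abel⟩
  map_add' := by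
    intro a b
    ext x y f
    simp only [Submodule.coe_add, Pi.add_apply, LinearMap.add_apply, LinearMap.coe_mk,
      AddHom.coe_mk, Preadditive.comp_add, Preadditive.add_comp]
    abel
  map_smul' := by
    intro c a
    ext x y f
    simp only [Submodule.coe_smul, Pi.smul_apply, LinearMap.smul_apply, LinearMap.coe_mk,
      AddHom.coe_mk, Linear.comp_smul, Linear.smul_comp, smul_sub, RingHom.id_apply]

/-- The first Hochschild-Mitchell cohomology: derivations modulo inner derivations. -/
abbrev HH1 : Type _ := catDerivations k C ⧸ LinearMap.range (innerDerivation k C)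

end Linear

/-- Walks from an object `x` to an object `y`: finite sequences of composable virtual morphisms
`(f, 1)` (traversed from source to target) and `(f, -1)` (traversed from target to source), with
`f` a non-zero morphism. -/
inductive CatWalk {C : Type u} [Category.{v} C] [Preadditive C] : C → C → Type (max u v)
  | nil (x : C) : CatWalk x x
  | pos {x y z : C} (p : CatWalk x y) (f : y ⟶ z) (hf : f ≠ 0) : CatWalk x z
  | neg {x y z : C} (p : CatWalk x y) (f : z ⟶ y) (hf : f ≠ 0) : CatWalk x z

/-- A linear category is connected if any two objects are joined by a walk. -/
def CatConnected (C : Type u) [Category.{v} C] [Preadditive C] : Prop :=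
  ∀ x y : C, Nonempty (CatWalk x y)

/-! ### The Hurewicz morphism of a grading -/

namespace CatGrading

variable {k : Type w} [Field k] {C : Type u} [Category.{v} C] [Preadditive C] [Linear k C]
variable {Γ : Type*} [Group Γ] (X : CatGrading k C Γ)

/-- The linear endomorphism of `x ⟶ y` which multiplies a homogeneous morphism of degree `s`
by `χ s`. -/
def eulerianMap (χ : Additive Γ →+ k) (x y : C) : (x ⟶ y) →ₗ[k] (x ⟶ y) :=
  letI := Classical.decEq Γ
  (DirectSum.toModule k Γ (x ⟶ y)
      fun s => χ (Additive.ofMul s) • (X.comp s x y).subtype) ∘ₗ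
    ((LinearEquiv.ofBijective (DirectSum.coeLinearMap fun s : Γ => X.comp s x y)
      (X.isInternal x y)).symm : (x ⟶ y) →ₗ[k] _)

theorem eulerianMap_of_mem (χ : Additive Γ →+ k) {x y : C} {s : Γ} {f : x ⟶ y}
    (hf : f ∈ X.comp s x y) : X.eulerianMap χ x y f = χ (Additive.ofMul s) • f := by
  let _ := Classical.decEq Γ
  have h : (LinearEquiv.ofBijective (DirectSum.coeLinearMap fun s : Γ => X.comp s x y)
      (X.isInternal x y)).symm f = DirectSum.lof k Γ (fun s => X.comp s x y) s ⟨f, hf⟩ := by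
    rw [LinearEquiv.symm_apply_eq]
    exact (DirectSum.coeLinearMap_lof (fun s : Γ => X.comp s x y) s ⟨f, hf⟩).symm
  unfold eulerianMap
  rw [LinearMap.comp_apply, LinearEquiv.coe_coe, h, DirectSum.toModule_lof]
  rfl

@[elab_as_elim]
theorem hom_induction {x y : C} {P : (x ⟶ y) → Prop} (f : x ⟶ y) (h0 : P 0)
    (hadd : ∀ f g, P f → P g → P (f + g)) (hhom : ∀ s, ∀ f ∈ X.comp s x y, P f) : P f := by
  let _ := Classical.decEq Γ
  have hf : f ∈ ⨆ s : Γ, X.comp s x y := by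
    rw [(X.isInternal x y).submodule_iSup_eq_top]; trivial
  exact Submodule.iSup_induction (fun s : Γ => X.comp s x y) (motive := P) hf hhom h0 hadd

/-- The Eulerian derivation `f ↦ χ (deg f) f` attached to an abelian character `χ`. -/
def eulerian (χ : Additive Γ →+ k) : catDerivations k C :=
  ⟨X.eulerianMap χ, by
    intro x y z f g
    refine X.hom_induction f ?_ ?_ ?_
    · simp only [Limits.zero_comp, map_zero, add_zero]
    · intro f f' h h'
      simp only [Preadditive.add_comp, map_add, h, h']
      abel
    intro s f hf
    refine X.hom_induction g ?_ ?_ ?_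
    · simp only [Limits.comp_zero, map_zero, add_zero]
    · intro g g' h h'
      simp only [Preadditive.comp_add, map_add, h, h']
      abel
    intro t g hg
    rw [X.eulerianMap_of_mem χ hf, X.eulerianMap_of_mem χ hg,
      X.eulerianMap_of_mem χ (X.comp_mem hf hg), ofMul_mul, map_add, add_smul,
      Linear.comp_smul, Linear.smul_comp]⟩

/-- The Hurewicz morphism `Hom (Γ, k⁺) → HH¹`: it sends an abelian character to the class of its
Eulerian derivation. -/
def hurewicz : (Additive Γ →+ k) →ₗ[k] HH1 k C :=
  (LinearMap.range (innerDerivation k C)).mkQ ∘ₗ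
    { toFun := X.eulerian
      map_add' := by
        intro χ χ'
        apply Subtype.ext
        funext x y
        ext f
        refine X.hom_induction f ?_ ?_ ?_
        · simp only [map_zero]
        · intro f g h h'
          simp only [map_add, h, h']
        intro s f hf
        change X.eulerianMap _ x y f = X.eulerianMap _ x y f + X.eulerianMap _ x y f
        simp only [X.eulerianMap_of_mem _ hf, AddMonoidHom.add_apply, add_smul]
      map_smul' := by
        intro c χ
        apply Subtype.ext
        funext x y
        ext f
        refine X.hom_induction f ?_ ?_ ?_
        · simp only [map_zero]
        · intro f g h h'
          simp only [map_add, h, h']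
        intro s f hf
        change X.eulerianMap _ x y f = c • X.eulerianMap _ x y f
        simp only [X.eulerianMap_of_mem _ hf, AddMonoidHom.smul_apply, smul_eq_mul, mul_smul] }

end CatGrading

/-! ### The CW-complex of a Schurian category -/

/-- A choice of a non-zero morphism `e x y : x ⟶ y` in each non-zero space of morphisms, with
`e x x = 𝟙 x`. -/
structure MorphismChoice (C : Type u) [Category.{v} C] [Preadditive C] where
  e : ∀ x y : C, x ⟶ y
  e_ne_zero : ∀ {x y : C} (f : x ⟶ y), f ≠ 0 → e x y ≠ 0
  e_self : ∀ x : C, e x x = 𝟙 x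

namespace MorphismChoice

variable {C : Type u} [Category.{v} C] [Preadditive C] (E : MorphismChoice C)

/-- The 1-cells: the chosen non-zero morphisms between distinct objects. -/
structure Edge where
  src : C
  tgt : C
  ne : src ≠ tgt
  ne_zero : E.e src tgt ≠ 0

/-- The 2-cells: triples of objects `x, y, z` with `x ≠ y`, `y ≠ z` such that the chosen morphisms
`x ⟶ y` and `y ⟶ z` have a non-zero composition.  The case `x = z` is allowed. -/
structure Triangle where
  x : C
  y : C
  z : C
  ne_xy : x ≠ y
  ne_yz : y ≠ z
  comp_ne_zero : E.e x y ≫ E.e y z ≠ 0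

/-- The model of a closed 2-cell: the triangle with vertices `(0, 0)`, `(1, 0)` and `(1, 1)`. -/
def ModelTriangle : Type := {p : ℝ × ℝ // 0 ≤ p.2 ∧ p.2 ≤ p.1 ∧ p.1 ≤ 1}

instance : TopologicalSpace ModelTriangle :=
  inferInstanceAs (TopologicalSpace {p : ℝ × ℝ // 0 ≤ p.2 ∧ p.2 ≤ p.1 ∧ p.1 ≤ 1})

/-- The side from `(0, 0)` to `(1, 0)`. -/
def ModelTriangle.side01 (t : unitInterval) : ModelTriangle :=
  ⟨((t : ℝ), 0), le_refl _, t.2.1, t.2.2⟩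

/-- The side from `(1, 0)` to `(1, 1)`. -/
def ModelTriangle.side12 (t : unitInterval) : ModelTriangle :=
  ⟨(1, (t : ℝ)), t.2.1, t.2.2, le_refl _⟩

/-- The side from `(0, 0)` to `(1, 1)`. -/
def ModelTriangle.side02 (t : unitInterval) : ModelTriangle :=
  ⟨((t : ℝ), (t : ℝ)), t.2.1, le_refl _, t.2.2⟩

/-- The disjoint union of all closed cells: a point for each object, an interval for each 1-cell,
a triangle for each 2-cell. -/
abbrev Cells : Type u :=
  (Σ _ : C, Unit) ⊕ (Σ _ : E.Edge, unitInterval) ⊕ (Σ _ : E.Triangle, ModelTriangle)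

/-- The point of a vertex. -/
def vertexCell (x : C) : E.Cells := Sum.inl ⟨x, ()⟩

open Classical in
/-- The point of parameter `t` on the 1-cell of the chosen morphism `x ⟶ y`; if `x = y`, where
there is no 1-cell, this is the vertex `x`. -/
def edgeCell {x y : C} (h : E.e x y ≠ 0) (t : unitInterval) : E.Cells :=
  if hxy : x = y then E.vertexCell x else Sum.inr (Sum.inl ⟨⟨x, y, hxy, h⟩, t⟩)

/-- A point of the closed 2-cell `T`. -/
def triangleCell (T : E.Triangle) (p : ModelTriangle) : E.Cells := Sum.inr (Sum.inr ⟨T, p⟩)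

variable {E} in
theorem Triangle.ne_zero_xy (T : E.Triangle) : E.e T.x T.y ≠ 0 := fun h =>
  T.comp_ne_zero (by rw [h, Limits.zero_comp])

variable {E} in
theorem Triangle.ne_zero_yz (T : E.Triangle) : E.e T.y T.z ≠ 0 := fun h =>
  T.comp_ne_zero (by rw [h, Limits.comp_zero])

variable {E} in
theorem Triangle.ne_zero_xz (T : E.Triangle) : E.e T.x T.z ≠ 0 :=
  E.e_ne_zero _ T.comp_ne_zero

/-- The gluing: a 1-cell `x ⟶ y` is attached to its end points, and the three sides of a 2-cell
`x, y, z` are attached to the 1-cells `x ⟶ y`, `y ⟶ z` and `x ⟶ z` (the last one being replaced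
by the vertex `x` if `x = z`). -/
inductive Glue : E.Cells → E.Cells → Prop
  | edge_zero (a : E.Edge) : Glue (E.edgeCell a.ne_zero 0) (E.vertexCell a.src)
  | edge_one (a : E.Edge) : Glue (E.edgeCell a.ne_zero 1) (E.vertexCell a.tgt)
  | side01 (T : E.Triangle) (t : unitInterval) :
      Glue (E.triangleCell T (ModelTriangle.side01 t)) (E.edgeCell T.ne_zero_xy t)
  | side12 (T : E.Triangle) (t : unitInterval) :
      Glue (E.triangleCell T (ModelTriangle.side12 t)) (E.edgeCell T.ne_zero_yz t)
  | side02 (T : E.Triangle) (t : unitInterval) :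
      Glue (E.triangleCell T (ModelTriangle.side02 t)) (E.edgeCell T.ne_zero_xz t)

/-- The CW-complex attached to the category, with the quotient topology. -/
def CW : Type u := Quot E.Glue

instance : TopologicalSpace E.CW := inferInstanceAs (TopologicalSpace (Quot E.Glue))

/-- The projection of the disjoint union of the closed cells onto the CW-complex. -/
def toCW (p : E.Cells) : E.CW := Quot.mk E.Glue p

theorem continuous_toCW : Continuous E.toCW := continuous_quot_mk

/-- The 0-cell of an object. -/
def vertex (x : C) : E.CW := E.toCW (E.vertexCell x)

theorem continuous_edgeCell {x y : C} (h : E.e x y ≠ 0) : Continuous (E.edgeCell h) := by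
  by_cases hxy : x = y
  · have : E.edgeCell h = fun _ => E.vertexCell x := by
      funext t; simp [edgeCell, hxy]
    rw [this]; exact continuous_const
  · have : E.edgeCell h = fun t => Sum.inr (Sum.inl ⟨⟨x, y, hxy, h⟩, t⟩) := by
      funext t; simp [edgeCell, hxy]
    rw [this]
    exact continuous_inr.comp (continuous_inl.comp continuous_sigmaMk)

/-- The path in the CW-complex along the 1-cell `x ⟶ y` (the constant path if `x = y`). -/
def edgePath {x y : C} (h : E.e x y ≠ 0) : Path (E.vertex x) (E.vertex y) where
  toFun t := E.toCW (E.edgeCell h t)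
  continuous_toFun := E.continuous_toCW.comp (E.continuous_edgeCell h)
  source' := by
    by_cases hxy : x = y
    · simp [edgeCell, hxy, vertex]
    · exact Quot.sound (Glue.edge_zero ⟨x, y, hxy, h⟩)
  target' := by
    by_cases hxy : x = y
    · simp [edgeCell, hxy, vertex]
    · exact Quot.sound (Glue.edge_one ⟨x, y, hxy, h⟩)

/-- The path in the CW-complex described by a walk. -/
def walkPath {x : C} : ∀ {y : C}, CatWalk x y → Path (E.vertex x) (E.vertex y)
  | _, .nil _ => Path.refl _
  | _, .pos p f hf => (walkPath p).trans (E.edgePath (E.e_ne_zero f hf))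
  | _, .neg p f hf => (walkPath p).trans (E.edgePath (E.e_ne_zero f hf)).symm

/-- The fundamental group of the CW-complex at the vertex `c₀`.  The product of two classes of
loops is `[q] [p] = [p followed by q]`. -/
abbrev pi1 (c₀ : C) : Type u := FundamentalGroup E.CW (E.vertex c₀)

/-- Given connector walks `u x` from `c₀` to `x`, the class of the loop
`(u y)⁻¹ e (u x)`, where `e` is the chosen morphism `x ⟶ y`. -/
def loopDeg {c₀ : C} (u : ∀ x : C, CatWalk c₀ x) {x y : C} (h : E.e x y ≠ 0) : E.pi1 c₀ :=
  FundamentalGroup.fromPath (Path.Homotopic.Quotient.mk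
    (((E.walkPath (u x)).trans (E.edgePath h)).trans (E.walkPath (u y)).symm))

end MorphismChoice

namespace MorphismChoice

variable {C : Type u} [Category.{v} C] [Preadditive C] (E : MorphismChoice C)

instance : ContractibleSpace ModelTriangle := by
  have hc : Convex ℝ {p : ℝ × ℝ | 0 ≤ p.2 ∧ p.2 ≤ p.1 ∧ p.1 ≤ 1} := by
    rintro ⟨a, b⟩ ⟨h1, h2, h3⟩ ⟨c, d⟩ ⟨h4, h5, h6⟩ r s hr hs hrs
    simp only [Prod.smul_mk, Prod.mk_add_mk, smul_eq_mul, Set.mem_ofPred_eq] at *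
    refine ⟨by positivity, by gcongr, ?_⟩
    nlinarith
  exact hc.contractibleSpace ⟨(0, 0), by norm_num⟩

theorem continuous_triangleCell (T : E.Triangle) : Continuous (E.triangleCell T) :=
  continuous_inr.comp (continuous_inr.comp continuous_sigmaMk)

/-- In the CW-complex, the path along `x ⟶ y` and then `y ⟶ z` is homotopic to the path
along `x ⟶ z`, as soon as the composition of the chosen morphisms is non-zero. -/
theorem edgePath_trans {x y z : C} (hxy : E.e x y ≠ 0) (hyz : E.e y z ≠ 0) (hxz : E.e x z ≠ 0)
    (h : E.e x y ≫ E.e y z ≠ 0) :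
    ((E.edgePath hxy).trans (E.edgePath hyz)).Homotopic (E.edgePath hxz) := by
  by_cases h1 : x = y
  · subst h1
    have : E.edgePath hxy = Path.refl _ := by
      ext t; change E.toCW (E.edgeCell _ t) = E.toCW (E.vertexCell _); simp [edgeCell]
    rw [this]
    exact ⟨Path.Homotopy.reflTrans _⟩
  by_cases h2 : y = z
  · subst h2
    have : E.edgePath hyz = Path.refl _ := by
      ext t; change E.toCW (E.edgeCell _ t) = E.toCW (E.vertexCell _); simp [edgeCell]
    rw [this]
    exact ⟨Path.Homotopy.transRefl _⟩
  let T : E.Triangle := ⟨x, y, z, h1, h2, h⟩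
  let P : ModelTriangle → E.CW := fun p => E.toCW (E.triangleCell T p)
  have hP : Continuous P := E.continuous_toCW.comp (E.continuous_triangleCell T)
  let v0 : ModelTriangle := ⟨(0, 0), by norm_num⟩
  let v1 : ModelTriangle := ⟨(1, 0), by norm_num⟩
  let v2 : ModelTriangle := ⟨(1, 1), by norm_num⟩
  let a : Path v0 v1 :=
    { toFun := ModelTriangle.side01
      continuous_toFun := Continuous.subtype_mk (by fun_prop) _
      source' := rfl
      target' := rfl }
  let b : Path v1 v2 :=
    { toFun := ModelTriangle.side12
      continuous_toFun := Continuous.subtype_mk (by fun_prop) _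
      source' := rfl
      target' := rfl }
  let c : Path v0 v2 :=
    { toFun := ModelTriangle.side02
      continuous_toFun := Continuous.subtype_mk (by fun_prop) _
      source' := rfl
      target' := rfl }
  have ha : ∀ t, P (a t) = E.edgePath hxy t := fun t => Quot.sound (Glue.side01 T t)
  have hb : ∀ t, P (b t) = E.edgePath hyz t := fun t => Quot.sound (Glue.side12 T t)
  have hcc : ∀ t, P (c t) = E.edgePath hxz t := fun t => Quot.sound (Glue.side02 T t)
  have e0 : P v0 = E.vertex x := by simpa using ha 0
  have e1 : P v1 = E.vertex y := by simpa using ha 1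
  have e2 : P v2 = E.vertex z := by simpa using hb 1
  have ha' : E.edgePath hxy = (a.map hP).cast e0.symm e1.symm := by
    ext t; exact (ha t).symm
  have hb' : E.edgePath hyz = (b.map hP).cast e1.symm e2.symm := by
    ext t; exact (hb t).symm
  have hc' : E.edgePath hxz = (c.map hP).cast e0.symm e2.symm := by
    ext t; exact (hcc t).symm
  have key : ((a.trans b).map hP).Homotopic (c.map hP) :=
    (SimplyConnectedSpace.paths_homotopic (a.trans b) c).map ⟨P, hP⟩
  have key2 := key.pathCast e0.symm e2.symm
  rw [ha', hb', hc']
  convert key2 using 1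
  ext t
  simp [Path.trans_apply]

theorem loopDeg_mul {c₀ : C} (u : ∀ x : C, CatWalk c₀ x) {x y z : C} (hxy : E.e x y ≠ 0)
    (hyz : E.e y z ≠ 0) (hxz : E.e x z ≠ 0) (h : E.e x y ≫ E.e y z ≠ 0) :
    E.loopDeg u hyz * E.loopDeg u hxy = E.loopDeg u hxz := by
  have key := Path.Homotopic.Quotient.eq.2 (E.edgePath_trans hxy hyz hxz h)
  rw [FundamentalGroup.mul_def]
  simp only [loopDeg, FundamentalGroup.fromPath, FundamentalGroup.fromArrow]
  simp only [Path.Homotopic.Quotient.mk_trans, Path.Homotopic.Quotient.mk_symm] at key ⊢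
  rw [← key]
  simp only [Path.Homotopic.Quotient.trans_assoc]
  congr 2
  rw [← Path.Homotopic.Quotient.trans_assoc (Path.Homotopic.Quotient.symm _),
    Path.Homotopic.Quotient.symm_trans, Path.Homotopic.Quotient.refl_trans]

variable (k : Type w) [Field k] [Linear k C]

theorem exists_smul (hS : IsSchurian k C) {x y : C} (h : E.e x y ≠ 0) (f : x ⟶ y) :
    ∃ c : k, f = c • E.e x y := by
  rcases hS x y with h0 | h1
  · have := rank_zero_iff.1 h0
    exact absurd (Subsingleton.elim _ _) h
  · obtain ⟨c, hc⟩ := (finrank_eq_one_iff_of_nonzero' _ h).1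
      (Module.finrank_eq_of_rank_eq (by simpa using h1)) f
    exact ⟨c, hc.symm⟩

/-- A family of subspaces, all zero except one which is the whole space, is a direct sum
decomposition. -/
theorem isInternal_of_single {k : Type*} [Field k] {ι : Type*} [DecidableEq ι] {M : Type*}
    [AddCommGroup M] [Module k M] (p : ι → Submodule k M) (i : ι) (hi : p i = ⊤)
    (hne : ∀ j, j ≠ i → p j = ⊥) : DirectSum.IsInternal p := by
  rw [DirectSum.isInternal_submodule_iff_iSupIndep_and_iSup_eq_top]
  refine ⟨fun j => ?_, eq_top_iff.2 (hi ▸ le_iSup p i)⟩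
  by_cases hj : j = i
  · subst hj
    have : (⨆ l, ⨆ (_ : l ≠ j), p l) = ⊥ := by
      simp only [iSup_eq_bot]
      exact hne
    rw [this]
    exact disjoint_bot_right
  · rw [hne j hj]
    exact disjoint_bot_left

/-- The grading of a Schurian category by the fundamental group of its CW-complex: the chosen
morphism `e : x ⟶ y` is homogeneous of degree the class of `(u y)⁻¹ e (u x)`. -/
def universalGrading (hS : IsSchurian k C) {c₀ : C} (u : ∀ x : C, CatWalk c₀ x) :
    CatGrading k C (E.pi1 c₀) where
  comp s x y := Submodule.span k {f | ∃ h : E.e x y ≠ 0, E.loopDeg u h = s ∧ f = E.e x y}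
  isInternal := by
    intro x y
    let _ := Classical.decEq (E.pi1 c₀)
    by_cases h : E.e x y ≠ 0
    · refine isInternal_of_single _ (E.loopDeg u h) ?_ ?_
      · rw [eq_top_iff]
        intro f _
        obtain ⟨c, rfl⟩ := E.exists_smul k hS h f
        exact Submodule.smul_mem _ _ (Submodule.subset_span ⟨h, rfl, rfl⟩)
      · intro s hs
        rw [Submodule.span_eq_bot]
        rintro f ⟨h', rfl, rfl⟩
        exact absurd rfl hs
    · have h0 : ∀ f : x ⟶ y, f = 0 := fun f => by
        by_contra hf
        exact h (E.e_ne_zero f hf)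
      refine isInternal_of_single _ 1 ?_ fun s _ => ?_
      · rw [eq_top_iff]
        intro f _
        rw [h0 f]
        exact Submodule.zero_mem _
      · rw [Submodule.eq_bot_iff]
        exact fun f _ => h0 f
  comp_mem := by
    intro x y z s t f g hf hg
    induction hf using Submodule.span_induction with
    | zero => rw [Limits.zero_comp]; exact Submodule.zero_mem _
    | add a b _ _ ha hb => rw [Preadditive.add_comp]; exact Submodule.add_mem _ ha hb
    | smul c a _ ha => rw [Linear.smul_comp]; exact Submodule.smul_mem _ _ ha
    | mem f hf =>
      induction hg using Submodule.span_induction with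
      | zero => rw [Limits.comp_zero]; exact Submodule.zero_mem _
      | add a b _ _ ha hb => rw [Preadditive.comp_add]; exact Submodule.add_mem _ ha hb
      | smul c a _ ha => rw [Linear.comp_smul]; exact Submodule.smul_mem _ _ ha
      | mem g hg =>
        obtain ⟨hxy, rfl, rfl⟩ := hf
        obtain ⟨hyz, rfl, rfl⟩ := hg
        by_cases h : E.e x y ≫ E.e y z = 0
        · rw [h]; exact Submodule.zero_mem _
        have hxz : E.e x z ≠ 0 := E.e_ne_zero _ h
        obtain ⟨c, hc⟩ := E.exists_smul k hS hxz (E.e x y ≫ E.e y z)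
        rw [hc]
        exact Submodule.smul_mem _ _
          (Submodule.subset_span ⟨hxz, (E.loopDeg_mul u hxy hyz hxz h).symm, rfl⟩)

end MorphismChoice

end

/-!
The Hurewicz morphism is compared with the restriction to the 1-cells.  The spaces of morphisms are
at most one-dimensional, so a derivation multiplies each chosen morphism `x ⟶ y` by a scalar
`c x y`, and Leibniz' rule says that `c x z = c x y + c y z` whenever the composition of the chosen
morphisms is non-zero, i.e. that `c` is a cellular 1-cocycle of the CW-complex.  Likewise the inner
derivations are the coboundaries `l y - l x`, and the Eulerian derivation of a character `χ` is the
cocycle of the values of `χ` on the loops `(u y)⁻¹ e (u x)`.  So the theorem says that the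
characters of the fundamental group are the cellular 1-cocycles modulo the coboundaries.  Up to
coboundaries the connectors `u x` do not matter, and it is convenient to work with characters of the
whole fundamental groupoid, the structure `PathCharacter`.  Both halves use the cover of the
CW-complex by the open stars of the vertices, defined through barycentric coordinates (`weight`).

*Injectivity.*  Let a character `F` have the values `l y - l x` on the 1-cells.  Pushing points
towards the vertex `x` (`pushHomotopy`) deforms the identity of the CW-complex into a map that
contracts the neighbourhood `1 / 4 < weight x` of `x` to the vertex.  The pushes preserve each
closed cell, and these are simply connected, so `l` extends to a function on all points which
measures `F` along every such push (`exists_value_of_coboundary`).  Hence `F` is locally the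
coboundary of that function, so it is one globally (`PathCharacter.eval_eq_sub_of_local`), and it
vanishes on loops.

*Surjectivity.*  A cellular cocycle defines potentials on the vertices of each closed cell.  On the
intersection of two open stars the differences of potentials are locally constant and form a Čech
cocycle (`starCocycle`), hence a covering of the CW-complex whose fibers are copies of the discrete
group of coefficients.  The monodromy of this covering is a character of the fundamental groupoid
(`CechCocycle.exists_pathCharacter`), and it has the given values on the 1-cells
(`exists_pathCharacter_of_cocycle`).
-/

/-! ### Characters of the fundamental groupoid -/

namespace FundamentalGroup

variable {X : Type*} [TopologicalSpace X] {A : Type*} [AddCommGroup A] {b : X}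
variable (χ : Additive (FundamentalGroup X b) →+ A)

/-- The value of `χ` on the class of a loop. -/
noncomputable def evalLoop (γ : Path b b) : A :=
  χ (Additive.ofMul (fromPath (Path.Homotopic.Quotient.mk γ)))

theorem evalLoop_trans (γ γ' : Path b b) :
    evalLoop χ (γ.trans γ') = evalLoop χ γ + evalLoop χ γ' := by
  rw [add_comm]
  exact χ.map_add (Additive.ofMul (fromPath (Path.Homotopic.Quotient.mk γ')))
    (Additive.ofMul (fromPath (Path.Homotopic.Quotient.mk γ)))

theorem evalLoop_congr {γ γ' : Path b b}
    (h : Path.Homotopic.Quotient.mk γ = Path.Homotopic.Quotient.mk γ') :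
    evalLoop χ γ = evalLoop χ γ' := by
  rw [evalLoop, h, evalLoop]

end FundamentalGroup

/-- An `A`-valued character of the fundamental groupoid of `X`: a homotopy invariant function on
the paths of `X`, additive under concatenation. -/
structure PathCharacter (X : Type*) [TopologicalSpace X] (A : Type*) [AddCommGroup A] where
  eval : ∀ {p q : X}, Path p q → A
  eval_homotopic : ∀ {p q : X} {γ γ' : Path p q}, γ.Homotopic γ' → eval γ = eval γ'
  eval_trans : ∀ {p q r : X} (γ : Path p q) (γ' : Path q r),
    eval (γ.trans γ') = eval γ + eval γ'

namespace PathCharacter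

variable {X : Type*} [TopologicalSpace X] {A : Type*} [AddCommGroup A]
variable (F : PathCharacter X A)

theorem eval_refl (p : X) : F.eval (Path.refl p) = 0 := by
  have h := F.eval_trans (Path.refl p) (Path.refl p)
  rw [Path.refl_trans_refl] at h
  exact left_eq_add.1 h

theorem eval_symm {p q : X} (γ : Path p q) : F.eval γ.symm = -F.eval γ := by
  have h := F.eval_homotopic ⟨Path.Homotopy.reflTransSymm γ⟩
  rw [F.eval_refl, F.eval_trans] at h
  exact eq_neg_of_add_eq_zero_right h.symm

/-- The value on a path depends only on its underlying function; its end points may be given by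
different expressions. -/
theorem eval_congr {p q p' q' : X} {γ : Path p q} {γ' : Path p' q'} (h : ∀ t, γ t = γ' t) :
    F.eval γ = F.eval γ' := by
  obtain rfl : p = p' := by simpa using h 0
  obtain rfl : q = q' := by simpa using h 1
  obtain rfl : γ = γ' := Path.ext (funext h)
  rfl

theorem eval_eq_zero_of_const {p q : X} {γ : Path p q} (a : X) (h : ∀ t, γ t = a) :
    F.eval γ = 0 :=
  (F.eval_congr (γ' := Path.refl a) h).trans (F.eval_refl a)

/-- The pull-back of a character along a continuous map. -/
def comap {Y : Type*} [TopologicalSpace Y] (f : C(Y, X)) : PathCharacter Y A where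
  eval γ := F.eval (γ.map f.continuous)
  eval_homotopic h := F.eval_homotopic (h.map f)
  eval_trans γ γ' := by rw [Path.map_trans, F.eval_trans]

/-- On a simply connected space every character is the difference of the values of a potential
at the end points. -/
theorem exists_potential [SimplyConnectedSpace X] :
    ∃ P : X → A, ∀ {p q : X} (γ : Path p q), F.eval γ = P q - P p := by
  obtain ⟨x₀⟩ : Nonempty X := inferInstance
  refine ⟨fun p => F.eval (PathConnectedSpace.somePath x₀ p), fun {p q} γ => ?_⟩
  rw [eq_sub_iff_add_eq', ← F.eval_trans]
  exact F.eval_homotopic (SimplyConnectedSpace.paths_homotopic _ _)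

/-- A homotopy from the identity to `g` deforms a path `γ` into `g ∘ γ`, along the traces of the
end points of `γ`. -/
theorem eval_add_eval_evalAt {g : C(X, X)} (H : (ContinuousMap.id X).Homotopy g) {p q : X}
    (γ : Path p q) :
    F.eval γ + F.eval (H.evalAt q) = F.eval (H.evalAt p) + F.eval (γ.map g.continuous) := by
  have h := F.eval_homotopic (Path.Homotopic.map_trans_evalAt H γ)
  rw [F.eval_trans, F.eval_trans] at h
  exact h

/-- A character which is locally the difference of the values of a function `Λ` is so globally:
along a path `γ`, the defect `F (γ restricted to [0, t]) - Λ (γ t)` is locally constant in `t`. -/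
theorem eval_eq_sub_of_local (Λ : X → A)
    (h : ∀ p : X, ∃ W ∈ nhds p, ∀ {q r : X} (γ : Path q r), (∀ t, γ t ∈ W) →
      F.eval γ = Λ r - Λ q) {p q : X} (γ : Path p q) : F.eval γ = Λ q - Λ p := by
  let φ : unitInterval → A := fun t => F.eval (γ.subpath 0 t) - Λ (γ t)
  have hφ : IsLocallyConstant φ := by
    rw [IsLocallyConstant.iff_eventually_eq]
    intro t₀
    obtain ⟨W, hW, hWγ⟩ := h (γ t₀)
    obtain ⟨ε, hε, hεW⟩ := Metric.mem_nhds_iff.1 (γ.continuous.continuousAt hW)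
    filter_upwards [Metric.ball_mem_nhds t₀ hε] with t ht
    have hloc := hWγ (γ.subpath t₀ t) fun s => by
      have hs : γ.subpath t₀ t s ∈ Set.range (γ.subpath t₀ t) := ⟨s, rfl⟩
      rw [Path.range_subpath] at hs
      obtain ⟨r, hr, hrs⟩ := hs
      rw [← hrs]
      refine hεW (Metric.mem_ball.2 (lt_of_le_of_lt ?_ (Metric.mem_ball.1 ht)))
      rw [Subtype.dist_eq, Subtype.dist_eq]
      exact Real.dist_right_le_of_mem_uIcc (by
        rcases le_total t₀ t with h' | h'
        · rw [Set.uIcc_of_le h'] at hr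
          rw [Set.uIcc_comm, Set.uIcc_of_le (show (t₀ : ℝ) ≤ t from h')]
          exact hr
        · rw [Set.uIcc_of_ge h'] at hr
          rw [Set.uIcc_comm, Set.uIcc_of_ge (show (t : ℝ) ≤ t₀ from h')]
          exact hr)
    have htr := F.eval_homotopic ⟨Path.Homotopy.subpathTransSubpath γ 0 t₀ t⟩
    rw [F.eval_trans, hloc] at htr
    change F.eval (γ.subpath 0 t) - Λ (γ t) = F.eval (γ.subpath 0 t₀) - Λ (γ t₀)
    rw [← htr]
    abel
  have h01 := hφ.apply_eq_of_preconnectedSpace 1 0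
  have h1 : F.eval (γ.subpath 0 1) = F.eval γ := F.eval_congr fun t => by
    rw [Path.subpath_zero_one]; rfl
  have h0 : F.eval (γ.subpath 0 0) = 0 := by rw [Path.subpath_self, F.eval_refl]
  simp only [φ, h0, h1, Path.target, Path.source, zero_sub] at h01
  rw [sub_eq_iff_eq_add] at h01
  rw [h01]
  abel

/-- The restriction of a character of the fundamental groupoid to the fundamental group. -/
def restrict (b : X) : Additive (FundamentalGroup X b) →+ A where
  toFun γ := Quotient.lift (fun δ : Path b b => F.eval δ) (fun _ _ h => F.eval_homotopic h)
    (FundamentalGroup.toPath γ.toMul)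
  map_zero' := F.eval_refl b
  map_add' γ γ' := by
    obtain ⟨δ, rfl⟩ := Path.Homotopic.Quotient.mk_surjective γ
    obtain ⟨δ', rfl⟩ := Path.Homotopic.Quotient.mk_surjective γ'
    exact (F.eval_trans δ' δ).trans (add_comm _ _)

theorem restrict_mk (b : X) (γ : Path b b) :
    F.restrict b (Additive.ofMul (FundamentalGroup.fromPath (Path.Homotopic.Quotient.mk γ))) =
      F.eval γ := rfl

/-- On a path connected space a character of the fundamental group extends to the fundamental
groupoid. -/
theorem exists_eval_eq [PathConnectedSpace X] {b : X}
    (χ : Additive (FundamentalGroup X b) →+ A) :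
    ∃ F : PathCharacter X A, ∀ γ : Path b b, F.eval γ =
      χ (Additive.ofMul (FundamentalGroup.fromPath (Path.Homotopic.Quotient.mk γ))) := by
  let κ (p : X) : Path b p := PathConnectedSpace.somePath b p
  refine ⟨⟨fun {p q} γ => FundamentalGroup.evalLoop χ (((κ p).trans γ).trans (κ q).symm),
    fun {p q γ γ'} h => ?_, fun {p q r} γ γ' => ?_⟩, fun γ => ?_⟩
  · apply FundamentalGroup.evalLoop_congr
    simp only [Path.Homotopic.Quotient.mk_trans, Path.Homotopic.Quotient.eq.2 h]
  · rw [← FundamentalGroup.evalLoop_trans]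
    apply FundamentalGroup.evalLoop_congr
    simp only [Path.Homotopic.Quotient.mk_trans, Path.Homotopic.Quotient.mk_symm,
      Path.Homotopic.Quotient.trans_assoc]
    congr 2
    rw [← Path.Homotopic.Quotient.trans_assoc (Path.Homotopic.Quotient.symm _),
      Path.Homotopic.Quotient.symm_trans, Path.Homotopic.Quotient.refl_trans]
  · -- Conjugation by the loop `κ b` does not change the value of `χ`, as `A` is commutative.
    change FundamentalGroup.evalLoop χ (((κ b).trans γ).trans (κ b).symm) =
      FundamentalGroup.evalLoop χ γ
    have h : FundamentalGroup.evalLoop χ ((κ b).trans (κ b).symm) = 0 := by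
      refine (FundamentalGroup.evalLoop_congr χ (γ' := Path.refl b) ?_).trans χ.map_zero
      simp only [Path.Homotopic.Quotient.mk_trans, Path.Homotopic.Quotient.mk_symm,
        Path.Homotopic.Quotient.trans_symm, Path.Homotopic.Quotient.mk_refl]
    rw [FundamentalGroup.evalLoop_trans] at h
    rw [FundamentalGroup.evalLoop_trans, FundamentalGroup.evalLoop_trans, add_right_comm, h,
      zero_add]

end PathCharacter

/-! ### The covering given by a Čech cocycle and its monodromy -/

/-- The data of a principal covering with discrete commutative structure group `A`: an open cover
of `X`, with an index chosen at each point, and a locally constant `A`-valued Čech `1`-cocycle. -/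
structure CechCocycle (ι X A : Type*) [TopologicalSpace X] [AddCommGroup A] where
  baseSet : ι → Set X
  isOpen_baseSet : ∀ i, IsOpen (baseSet i)
  indexAt : X → ι
  mem_baseSet_at : ∀ x, x ∈ baseSet (indexAt x)
  g : ι → ι → X → A
  eventually_eq : ∀ i j, ∀ x ∈ baseSet i ∩ baseSet j, ∀ᶠ y in nhds x, g i j y = g i j x
  g_add : ∀ i j l, ∀ x ∈ baseSet i ∩ baseSet j ∩ baseSet l, g i j x + g j l x = g i l x

namespace CechCocycle

variable {ι X A : Type*} [TopologicalSpace X] [AddCommGroup A] (Z : CechCocycle ι X A)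

theorem g_self (i : ι) {x : X} (hx : x ∈ Z.baseSet i) : Z.g i i x = 0 :=
  left_eq_add.1 (Z.g_add i i i x ⟨⟨hx, hx⟩, hx⟩).symm

/-- A function `f` on the parameters of a path `γ` is a primitive of the cocycle along `γ` if,
read in the chosen charts at the points of `γ`, it is a continuous lift of `γ` to the covering
given by the cocycle. -/
def IsPrimitive {p q : X} (γ : Path p q) (f : unitInterval → A) : Prop :=
  ∀ t₀, ∀ᶠ t in nhds t₀, f t + Z.g (Z.indexAt (γ t)) (Z.indexAt (γ t₀)) (γ t) = f t₀

variable {Z} in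
theorem IsPrimitive.add_const {p q : X} {γ : Path p q} {f : unitInterval → A}
    (hf : Z.IsPrimitive γ f) (a : A) : Z.IsPrimitive γ fun t => f t + a := fun t₀ => by
  filter_upwards [hf t₀] with t ht
  rw [add_right_comm, ht]

section Covering

variable [TopologicalSpace A] [DiscreteTopology A]

/-- The covering given by the cocycle, as a fiber bundle. -/
def core : FiberBundleCore ι X A where
  baseSet := Z.baseSet
  isOpen_baseSet := Z.isOpen_baseSet
  indexAt := Z.indexAt
  mem_baseSet_at := Z.mem_baseSet_at
  coordChange i j x a := a + Z.g i j x
  coordChange_self i x hx a := by rw [Z.g_self i hx, add_zero]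
  continuousOn_coordChange i j := by
    rintro ⟨x, a⟩ ⟨hx, -⟩
    refine ContinuousAt.continuousWithinAt ?_
    have hg : ContinuousAt (Z.g i j) x :=
      (continuousAt_const (y := Z.g i j x)).congr
        ((Z.eventually_eq i j x hx).mono fun y hy => hy.symm)
    have hadd : Continuous fun z : A × A => z.1 + z.2 := continuous_of_discreteTopology
    exact hadd.continuousAt.comp
      (continuousAt_snd.prodMk (ContinuousAt.comp (f := Prod.fst) hg continuousAt_fst))
  coordChange_comp i j l x hx a := by rw [add_assoc, Z.g_add i j l x hx]

theorem isCoveringMap_proj : IsCoveringMap Z.core.proj :=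
  FiberBundle.isCoveringMap

/-- The point of the covering above `x` of coordinate `a` in the chosen chart at `x`. -/
def point (x : X) (a : A) : Z.core.TotalSpace := ⟨x, a⟩

/-- The coordinate of a point of the covering in the chosen chart. -/
def coord (z : Z.core.TotalSpace) : A := z.2

theorem isPrimitive_iff_continuous {p q : X} (γ : Path p q) (Γ : unitInterval → Z.core.TotalSpace)
    (h : ∀ t, (Γ t).1 = γ t) :
    Z.IsPrimitive γ (fun t => Z.coord (Γ t)) ↔ Continuous Γ := by
  rw [continuous_iff_continuousAt]
  refine forall_congr' fun t₀ => ?_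
  rw [FiberBundle.continuousAt_totalSpace]
  have h1 : ContinuousAt (fun t => (Γ t).proj) t₀ := by
    simp only [h]
    exact γ.continuous.continuousAt
  rw [and_iff_right h1]
  have h2 : ∀ t, ((trivializationAt A Z.core.Fiber (Γ t₀).proj) (Γ t)).2 =
      Z.coord (Γ t) + Z.g (Z.indexAt (γ t)) (Z.indexAt (γ t₀)) (γ t) := fun t => by
    rw [← h t, ← h t₀]; rfl
  have h3 : Z.coord (Γ t₀) + Z.g (Z.indexAt (γ t₀)) (Z.indexAt (γ t₀)) (γ t₀) =
      Z.coord (Γ t₀) := by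
    rw [Z.g_self _ (Z.mem_baseSet_at _), add_zero]
  simp only [ContinuousAt, nhds_discrete A, Filter.tendsto_pure, h2, h3]

/-- The lift to the covering of the path `γ`, starting at the coordinate `a`. -/
noncomputable def lift {p q : X} (γ : Path p q) (a : A) : C(unitInterval, Z.core.TotalSpace) :=
  Z.isCoveringMap_proj.liftPath γ (Z.point p a) γ.source

/-- The coordinate, in the chosen chart, of the end point of the lift of `γ` starting at `a`. -/
noncomputable def transport {p q : X} (γ : Path p q) (a : A) : A :=
  Z.coord (Z.lift γ a 1)

theorem transport_eq {p q : X} (γ : Path p q) (a : A) {f : unitInterval → A}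
    (hf : Z.IsPrimitive γ f) (h0 : f 0 = a) : Z.transport γ a = f 1 := by
  let Γ : unitInterval → Z.core.TotalSpace := fun t => Z.point (γ t) (f t)
  have hΓ : Γ = Z.lift γ a := by
    refine (Z.isCoveringMap_proj.eq_liftPath_iff _).2
      ⟨(Z.isPrimitive_iff_continuous γ Γ fun _ => rfl).1 hf, rfl, ?_⟩
    change Z.point (γ 0) (f 0) = Z.point p a
    rw [γ.source, h0]
  change Z.coord (Z.lift γ a 1) = Z.coord (Γ 1)
  rw [hΓ]

theorem lift_proj {p q : X} (γ : Path p q) (a : A) (t : unitInterval) :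
    (Z.lift γ a t).1 = γ t :=
  congrFun (Z.isCoveringMap_proj.liftPath_lifts γ (Z.point p a) γ.source) t

theorem exists_primitive {p q : X} (γ : Path p q) : ∃ f, Z.IsPrimitive γ f ∧ f 0 = 0 := by
  refine ⟨fun t => Z.coord (Z.lift γ 0 t),
    (Z.isPrimitive_iff_continuous γ _ (Z.lift_proj γ 0)).2 (Z.lift γ 0).continuous, ?_⟩
  have h : Z.lift γ 0 0 = Z.point p 0 :=
    Z.isCoveringMap_proj.liftPath_zero γ (Z.point p 0) γ.source
  simp only [h]
  rfl

/-- The lifts of a path are the translates of one of them. -/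
theorem transport_eq_add {p q : X} (γ : Path p q) (a : A) :
    Z.transport γ a = Z.transport γ 0 + a := by
  obtain ⟨f, hf, h0⟩ := Z.exists_primitive γ
  rw [Z.transport_eq γ 0 hf h0, Z.transport_eq γ a (hf.add_const a) (by rw [h0, zero_add])]

theorem transport_trans {p q r : X} (γ : Path p q) (γ' : Path q r) (a : A) :
    Z.transport (γ.trans γ') a = Z.transport γ' (Z.transport γ a) := by
  have hΓ : Z.lift γ a 1 = Z.point q (Z.transport γ a) := by
    have h1 : (Z.lift γ a 1).1 = q := (Z.lift_proj γ a 1).trans γ.target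
    have h2 : ∀ z : Z.core.TotalSpace, z.1 = q → z = Z.point q (Z.coord z) := by
      rintro z rfl
      rfl
    exact h2 _ h1
  have key : ∀ (z : Z.core.TotalSpace) (hz : γ' 0 = Z.core.proj z),
      z = Z.point q (Z.transport γ a) →
      Z.isCoveringMap_proj.liftPath γ' z hz 1 = Z.lift γ' (Z.transport γ a) 1 := by
    rintro _ hz rfl
    rfl
  have h := congrArg (fun Δ : C(unitInterval, Z.core.TotalSpace) => Δ 1)
    (Z.isCoveringMap_proj.liftPath_trans (e := Z.point p a) rfl γ γ')
  refine congrArg Z.coord (h.trans ?_)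
  simp only [ContinuousMap.coe_coe, Path.target]
  exact key _ _ hΓ

end Covering

/-- The monodromy of the covering given by a cocycle is a character of the fundamental groupoid,
computed by primitives. -/
theorem exists_pathCharacter : ∃ F : PathCharacter X A, ∀ {p q : X} (γ : Path p q)
    (f : unitInterval → A), Z.IsPrimitive γ f → F.eval γ = f 1 - f 0 := by
  let _ : TopologicalSpace A := ⊥
  have : DiscreteTopology A := ⟨rfl⟩
  refine ⟨⟨fun γ => Z.transport γ 0, fun {p q γ γ'} h => ?_, fun γ γ' => ?_⟩,
    fun {p q} γ f hf => ?_⟩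
  · exact congrArg Z.coord (Z.isCoveringMap_proj.liftPath_apply_one_eq_of_homotopicRel h
      (Z.point p 0) γ.source γ'.source)
  · rw [Z.transport_trans, Z.transport_eq_add, add_comm]
  · rw [eq_sub_iff_add_eq, ← Z.transport_eq_add]
    exact Z.transport_eq γ _ hf rfl

end CechCocycle

namespace MorphismChoice

/-! ### Barycentric coordinates of labelled simplices -/

section Simplices

variable {C : Type*}

open Classical in
/-- The barycentric coordinate of index `x` of the vertex `y`. -/
noncomputable def indicator (x y : C) : ℝ := if x = y then 1 else 0

theorem indicator_self (x : C) : indicator x x = 1 := if_pos rfl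

theorem indicator_of_ne {x y : C} (h : x ≠ y) : indicator x y = 0 := if_neg h

theorem indicator_nonneg (x y : C) : 0 ≤ indicator x y := by
  unfold indicator; split_ifs <;> norm_num

/-- The barycentric coordinate of index `x` at the point of parameter `t` of an edge from `y`
to `z`. -/
noncomputable def edgeWeight (x y z : C) (t : unitInterval) : ℝ :=
  (1 - (t : ℝ)) * indicator x y + (t : ℝ) * indicator x z

/-- The barycentric coordinate of index `x` at the point `p` of a triangle with vertices
`y₀, y₁, y₂`: the sum of the coordinates of `p` at the vertices labelled by `x`. -/
noncomputable def triangleWeight (x y₀ y₁ y₂ : C) (p : ModelTriangle) : ℝ :=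
  (1 - p.1.1) * indicator x y₀ + (p.1.1 - p.1.2) * indicator x y₁ + p.1.2 * indicator x y₂

theorem triangleWeight_side01 (x y₀ y₁ y₂ : C) (t : unitInterval) :
    triangleWeight x y₀ y₁ y₂ (ModelTriangle.side01 t) = edgeWeight x y₀ y₁ t := by
  simp only [triangleWeight, edgeWeight, ModelTriangle.side01]; ring

theorem triangleWeight_side12 (x y₀ y₁ y₂ : C) (t : unitInterval) :
    triangleWeight x y₀ y₁ y₂ (ModelTriangle.side12 t) = edgeWeight x y₁ y₂ t := by
  simp only [triangleWeight, edgeWeight, ModelTriangle.side12]; ring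

theorem triangleWeight_side02 (x y₀ y₁ y₂ : C) (t : unitInterval) :
    triangleWeight x y₀ y₁ y₂ (ModelTriangle.side02 t) = edgeWeight x y₀ y₂ t := by
  simp only [triangleWeight, edgeWeight, ModelTriangle.side02]; ring

theorem edgeWeight_zero (x y z : C) : edgeWeight x y z 0 = indicator x y := by
  simp [edgeWeight]

theorem edgeWeight_one (x y z : C) : edgeWeight x y z 1 = indicator x z := by
  simp [edgeWeight]

theorem continuous_edgeWeight (x y z : C) : Continuous (edgeWeight x y z) := by
  unfold edgeWeight
  fun_prop

theorem continuous_side01 : Continuous ModelTriangle.side01 :=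
  Continuous.subtype_mk (by fun_prop) _

theorem continuous_side12 : Continuous ModelTriangle.side12 :=
  Continuous.subtype_mk (by fun_prop) _

theorem continuous_side02 : Continuous ModelTriangle.side02 :=
  Continuous.subtype_mk (by fun_prop) _

theorem continuous_modelTriangle_val : Continuous fun p : ModelTriangle => p.1 :=
  continuous_subtype_val

theorem continuous_triangleWeight (x y₀ y₁ y₂ : C) :
    Continuous (triangleWeight x y₀ y₁ y₂) := by
  have h1 : Continuous fun p : ModelTriangle => p.1.1 :=
    continuous_fst.comp continuous_modelTriangle_val
  have h2 : Continuous fun p : ModelTriangle => p.1.2 :=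
    continuous_snd.comp continuous_modelTriangle_val
  unfold triangleWeight
  fun_prop

/-! ### Pushing a point of a simplex towards the vertices of a given label -/

/-- The speed at which, at time `s`, a point of weight `w` is pushed.  The cut-off at `1 / 4` makes
it continuous in `w`; for `w ≥ 1 / 4` the push is complete at time `1`. -/
noncomputable def pushRate (w : ℝ) (s : unitInterval) : ℝ := (s : ℝ) / max w (1 / 4)

theorem pushRate_zero (w : ℝ) : pushRate w 0 = 0 := by simp [pushRate]

theorem pushRate_one {w : ℝ} (h : 1 / 4 < w) : pushRate w 1 = w⁻¹ := by
  rw [pushRate, max_eq_left h.le, Set.Icc.coe_one, one_div]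

theorem max_quarter_pos (w : ℝ) : 0 < max w (1 / 4) := lt_max_of_lt_right (by norm_num)

/-- The factor by which the push multiplies the barycentric coordinate of a vertex, where `d` is
`1` if the vertex has the given label and `0` otherwise, and `w` is the sum of the barycentric
coordinates of the vertices which have it. -/
noncomputable def pushFactor (d w : ℝ) (s : unitInterval) : ℝ := 1 + pushRate w s * (d - w)

theorem pushFactor_nonneg {d : ℝ} (hd : 0 ≤ d) (w : ℝ) (s : unitInterval) :
    0 ≤ pushFactor d w s := by
  have hm := max_quarter_pos w
  have h1 : 0 ≤ pushRate w s := div_nonneg s.2.1 hm.le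
  have h2 : pushRate w s * w ≤ 1 := by
    rw [pushRate, div_mul_eq_mul_div, div_le_one hm]
    exact (mul_le_mul_of_nonneg_left (le_max_left w _) s.2.1).trans
      (mul_le_of_le_one_left hm.le s.2.2)
  have h3 := mul_nonneg h1 hd
  rw [pushFactor, mul_sub]
  linarith

theorem pushFactor_zero (d w : ℝ) : pushFactor d w 0 = 1 := by
  rw [pushFactor, pushRate_zero, zero_mul, add_zero]

/-- At time `1` only the vertices with the given label keep a non-zero coordinate. -/
theorem pushFactor_one {d w : ℝ} (h : 1 / 4 < w) : pushFactor d w 1 = d / w := by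
  have hw : w ≠ 0 := by linarith
  rw [pushFactor, pushRate_one h]
  field_simp
  ring

theorem continuous_pushFactor (d : ℝ) {Y : Type*} [TopologicalSpace Y] {w : Y → ℝ}
    {s : Y → unitInterval} (hw : Continuous w) (hs : Continuous s) :
    Continuous fun y => pushFactor d (w y) (s y) := by
  unfold pushFactor pushRate
  have h : ∀ y, max (w y) (1 / 4) ≠ 0 := fun y => (max_quarter_pos _).ne'
  fun_prop (disch := assumption)

/-- The push towards `x` of the point of parameter `t` of an edge from `y` to `z`. -/
noncomputable def edgePush (x y z : C) (t s : unitInterval) : unitInterval :=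
  ⟨(t : ℝ) * pushFactor (indicator x z) (edgeWeight x y z t) s, by
    have h0 := mul_nonneg t.2.1
      (pushFactor_nonneg (indicator_nonneg x z) (edgeWeight x y z t) s)
    have h1 := mul_nonneg (sub_nonneg.2 t.2.2)
      (pushFactor_nonneg (indicator_nonneg x y) (edgeWeight x y z t) s)
    refine ⟨h0, ?_⟩
    have h : (t : ℝ) * pushFactor (indicator x z) (edgeWeight x y z t) s +
        (1 - (t : ℝ)) * pushFactor (indicator x y) (edgeWeight x y z t) s = 1 := by
      unfold pushFactor edgeWeight
      ring
    linarith⟩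

/-- The push towards `x` of the point `p` of a triangle with vertices `y₀, y₁, y₂`. -/
noncomputable def trianglePush (x y₀ y₁ y₂ : C) (p : ModelTriangle) (s : unitInterval) :
    ModelTriangle :=
  ⟨((p.1.1 - p.1.2) * pushFactor (indicator x y₁) (triangleWeight x y₀ y₁ y₂ p) s +
      p.1.2 * pushFactor (indicator x y₂) (triangleWeight x y₀ y₁ y₂ p) s,
    p.1.2 * pushFactor (indicator x y₂) (triangleWeight x y₀ y₁ y₂ p) s), by
    have h0 := mul_nonneg (sub_nonneg.2 p.2.2.2)
      (pushFactor_nonneg (indicator_nonneg x y₀) (triangleWeight x y₀ y₁ y₂ p) s)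
    have h1 := mul_nonneg (sub_nonneg.2 p.2.2.1)
      (pushFactor_nonneg (indicator_nonneg x y₁) (triangleWeight x y₀ y₁ y₂ p) s)
    have h2 := mul_nonneg p.2.1
      (pushFactor_nonneg (indicator_nonneg x y₂) (triangleWeight x y₀ y₁ y₂ p) s)
    refine ⟨h2, le_add_of_nonneg_left h1, ?_⟩
    have h : (1 - p.1.1) * pushFactor (indicator x y₀) (triangleWeight x y₀ y₁ y₂ p) s +
        ((p.1.1 - p.1.2) * pushFactor (indicator x y₁) (triangleWeight x y₀ y₁ y₂ p) s +
        p.1.2 * pushFactor (indicator x y₂) (triangleWeight x y₀ y₁ y₂ p) s) = 1 := by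
      unfold pushFactor triangleWeight
      ring
    linarith⟩

theorem edgePush_zero (x y z : C) (t : unitInterval) : edgePush x y z t 0 = t :=
  Subtype.ext (by simp only [edgePush, pushFactor_zero, mul_one])

theorem trianglePush_zero (x y₀ y₁ y₂ : C) (p : ModelTriangle) :
    trianglePush x y₀ y₁ y₂ p 0 = p :=
  Subtype.ext (by simp only [trianglePush, pushFactor_zero, mul_one, sub_add_cancel])

theorem edgePush_left (x y z : C) (s : unitInterval) : edgePush x y z 0 s = 0 :=
  Subtype.ext (by simp [edgePush])

theorem edgePush_right (x y z : C) (s : unitInterval) : edgePush x y z 1 s = 1 :=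
  Subtype.ext (by simp [edgePush, pushFactor, edgeWeight])

theorem trianglePush_side01 (x y₀ y₁ y₂ : C) (t s : unitInterval) :
    trianglePush x y₀ y₁ y₂ (ModelTriangle.side01 t) s =
      ModelTriangle.side01 (edgePush x y₀ y₁ t s) :=
  Subtype.ext (by
    simp only [trianglePush, triangleWeight_side01]
    simp [ModelTriangle.side01, edgePush])

theorem trianglePush_side12 (x y₀ y₁ y₂ : C) (t s : unitInterval) :
    trianglePush x y₀ y₁ y₂ (ModelTriangle.side12 t) s =
      ModelTriangle.side12 (edgePush x y₁ y₂ t s) :=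
  Subtype.ext (by
    simp only [trianglePush, triangleWeight_side12]
    simp only [ModelTriangle.side12, edgePush, Prod.mk.injEq, and_true]
    unfold pushFactor edgeWeight
    ring)

theorem trianglePush_side02 (x y₀ y₁ y₂ : C) (t s : unitInterval) :
    trianglePush x y₀ y₁ y₂ (ModelTriangle.side02 t) s =
      ModelTriangle.side02 (edgePush x y₀ y₂ t s) :=
  Subtype.ext (by
    simp only [trianglePush, triangleWeight_side02]
    simp [ModelTriangle.side02, edgePush])

theorem continuous_edgePush (x y z : C) :
    Continuous fun q : unitInterval × unitInterval => edgePush x y z q.1 q.2 := by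
  refine Continuous.subtype_mk ?_ _
  exact (continuous_subtype_val.comp continuous_fst).mul
    (continuous_pushFactor _ ((continuous_edgeWeight x y z).comp continuous_fst) continuous_snd)

theorem continuous_trianglePush (x y₀ y₁ y₂ : C) :
    Continuous fun q : ModelTriangle × unitInterval => trianglePush x y₀ y₁ y₂ q.1 q.2 := by
  refine Continuous.subtype_mk ?_ _
  have hw := (continuous_triangleWeight x y₀ y₁ y₂).comp
    (continuous_fst : Continuous fun q : ModelTriangle × unitInterval => q.1)
  have h1 : Continuous fun q : ModelTriangle × unitInterval => q.1.1.1 :=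
    continuous_fst.comp (continuous_modelTriangle_val.comp continuous_fst)
  have h2 : Continuous fun q : ModelTriangle × unitInterval => q.1.1.2 :=
    continuous_snd.comp (continuous_modelTriangle_val.comp continuous_fst)
  have f1 := continuous_pushFactor (indicator x y₁) hw continuous_snd
  have f2 := continuous_pushFactor (indicator x y₂) hw continuous_snd
  exact (((h1.sub h2).mul f1).add (h2.mul f2)).prodMk (h2.mul f2)

/-- On an edge between distinct vertices the complete push ends at the vertex `x`. -/
theorem edgePush_one {x y z : C} (hyz : y ≠ z) {t : unitInterval}
    (h : 1 / 4 < edgeWeight x y z t) :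
    (x = y ∧ edgePush x y z t 1 = 0) ∨ (x = z ∧ edgePush x y z t 1 = 1) := by
  by_cases hy : x = y
  · refine Or.inl ⟨hy, Subtype.ext ?_⟩
    simp [edgePush, pushFactor_one h, indicator_of_ne (hy.trans_ne hyz)]
  by_cases hz : x = z
  · refine Or.inr ⟨hz, Subtype.ext ?_⟩
    have hw : edgeWeight x y z t = t := by
      rw [edgeWeight, indicator_of_ne hy, hz, indicator_self]; ring
    have ht : (t : ℝ) ≠ 0 := by
      rw [hw] at h; linarith
    simp only [edgePush, pushFactor_one h]
    rw [hw, hz, indicator_self]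
    exact mul_one_div_cancel ht
  · rw [edgeWeight, indicator_of_ne hy, indicator_of_ne hz] at h
    norm_num at h

/-- On a triangle with `y₀ ≠ y₁ ≠ y₂` the complete push ends at the vertex of label `x` if there is
only one, and on the side from `y₀` to `y₂` if `y₀ = x = y₂`. -/
theorem trianglePush_one {x y₀ y₁ y₂ : C} (h01 : y₀ ≠ y₁) (h12 : y₁ ≠ y₂) {p : ModelTriangle}
    (h : 1 / 4 < triangleWeight x y₀ y₁ y₂ p) :
    (x = y₀ ∧ trianglePush x y₀ y₁ y₂ p 1 = ModelTriangle.side01 0) ∨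
      (x = y₁ ∧ trianglePush x y₀ y₁ y₂ p 1 = ModelTriangle.side01 1) ∨
      (x = y₂ ∧ trianglePush x y₀ y₁ y₂ p 1 = ModelTriangle.side12 1) ∨
      (x = y₀ ∧ y₀ = y₂ ∧ ∃ t, trianglePush x y₀ y₁ y₂ p 1 = ModelTriangle.side02 t) := by
  have hw0 : triangleWeight x y₀ y₁ y₂ p ≠ 0 := by linarith
  by_cases h1 : x = y₁
  · refine Or.inr (Or.inl ⟨h1, Subtype.ext ?_⟩)
    have i0 : indicator x y₀ = 0 := indicator_of_ne (h1.trans_ne h01.symm)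
    have i2 : indicator x y₂ = 0 := indicator_of_ne (h1.trans_ne h12)
    have i1 : indicator x y₁ = 1 := by rw [h1, indicator_self]
    have hw : triangleWeight x y₀ y₁ y₂ p = p.1.1 - p.1.2 := by
      rw [triangleWeight, i0, i1, i2]; ring
    simp only [trianglePush, pushFactor_one h, ModelTriangle.side01, i1, i2]
    rw [hw] at hw0 ⊢
    refine Prod.ext ?_ (by simp)
    simpa using mul_inv_cancel₀ hw0
  have i1 : indicator x y₁ = 0 := indicator_of_ne h1
  by_cases h0 : x = y₀
  · by_cases h2 : x = y₂
    · refine Or.inr (Or.inr (Or.inr ⟨h0, h0.symm.trans h2,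
        ⟨(trianglePush x y₀ y₁ y₂ p 1).1.2, ?_, ?_⟩, Subtype.ext (Prod.ext ?_ rfl)⟩))
      · exact (trianglePush x y₀ y₁ y₂ p 1).2.1
      · exact (trianglePush x y₀ y₁ y₂ p 1).2.2.1.trans (trianglePush x y₀ y₁ y₂ p 1).2.2.2
      · simp [trianglePush, pushFactor_one h, ModelTriangle.side02, i1]
    · refine Or.inl ⟨h0, Subtype.ext ?_⟩
      simp [trianglePush, pushFactor_one h, ModelTriangle.side01, i1, indicator_of_ne h2]
  by_cases h2 : x = y₂
  · refine Or.inr (Or.inr (Or.inl ⟨h2, Subtype.ext ?_⟩))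
    have i0 : indicator x y₀ = 0 := indicator_of_ne h0
    have i2 : indicator x y₂ = 1 := by rw [h2, indicator_self]
    have hw : triangleWeight x y₀ y₁ y₂ p = p.1.2 := by
      rw [triangleWeight, i0, i1, i2]; ring
    simp only [trianglePush, pushFactor_one h, ModelTriangle.side12, i1, i2]
    rw [hw] at hw0 ⊢
    have := mul_inv_cancel₀ hw0
    simpa using this
  · rw [triangleWeight, indicator_of_ne h0, i1, indicator_of_ne h2] at h
    norm_num at h

theorem eq_of_indicator_pos {x y : C} (h : 0 < indicator x y) : x = y := by
  by_contra hxy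
  rw [indicator_of_ne hxy] at h
  exact h.false

theorem eq_or_eq_of_edgeWeight_pos {x y z : C} {t : unitInterval} (h : 0 < edgeWeight x y z t) :
    x = y ∨ x = z := by
  by_contra! hx
  rw [edgeWeight, indicator_of_ne hx.1, indicator_of_ne hx.2] at h
  norm_num at h

end Simplices

/-! ### Barycentric coordinates on the CW-complex -/

variable {C : Type u} [Category.{v} C] [Preadditive C] (E : MorphismChoice C)

/-- The barycentric coordinate of index `x` on the closed cells. -/
noncomputable def cellWeight (x : C) : E.Cells → ℝ
  | Sum.inl y => indicator x y.1
  | Sum.inr (Sum.inl a) => edgeWeight x a.1.src a.1.tgt a.2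
  | Sum.inr (Sum.inr T) => triangleWeight x T.1.x T.1.y T.1.z T.2

variable {E} in
theorem edgeCell_edge (a : E.Edge) (t : unitInterval) :
    E.edgeCell a.ne_zero t = Sum.inr (Sum.inl ⟨a, t⟩) := by
  simp [edgeCell, a.ne]

theorem edgeCell_self {x : C} (h : E.e x x ≠ 0) (t : unitInterval) :
    E.edgeCell h t = E.vertexCell x := by
  simp [edgeCell]

theorem cellWeight_edgeCell (x : C) {y z : C} (h : E.e y z ≠ 0) (t : unitInterval) :
    E.cellWeight x (E.edgeCell h t) = edgeWeight x y z t := by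
  by_cases hyz : y = z
  · subst hyz
    rw [edgeCell_self]
    simp only [vertexCell, cellWeight, edgeWeight]
    ring
  · exact congrArg (E.cellWeight x) (edgeCell_edge ⟨y, z, hyz, h⟩ t)

/-- The barycentric coordinate of index `x` on the CW-complex. -/
noncomputable def weight (x : C) : E.CW → ℝ :=
  Quot.lift (E.cellWeight x) (by
    rintro _ _ (a | a | ⟨T, t⟩ | ⟨T, t⟩ | ⟨T, t⟩)
    · exact (E.cellWeight_edgeCell x _ 0).trans (edgeWeight_zero x _ _)
    · exact (E.cellWeight_edgeCell x _ 1).trans (edgeWeight_one x _ _)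
    · rw [cellWeight_edgeCell]; exact triangleWeight_side01 x _ _ _ t
    · rw [cellWeight_edgeCell]; exact triangleWeight_side12 x _ _ _ t
    · rw [cellWeight_edgeCell]; exact triangleWeight_side02 x _ _ _ t)

theorem continuous_weight (x : C) : Continuous (E.weight x) := by
  refine continuous_quot_lift _ ?_
  refine continuous_sum_dom.2 ⟨continuous_sigma fun y =>
      (continuous_const : Continuous fun _ : Unit => indicator x y),
    continuous_sum_dom.2 ⟨continuous_sigma fun a => ?_, continuous_sigma fun T => ?_⟩⟩
  · exact continuous_edgeWeight x a.src a.tgt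
  · exact continuous_triangleWeight x T.x T.y T.z

/-- As the barycentric coordinates of a point sum up to `1` and at most three of them are non-zero,
one of them is larger than `1 / 4`. -/
theorem exists_weight_gt (p : E.CW) : ∃ x, 1 / 4 < E.weight x p := by
  obtain ⟨y | ⟨a, t⟩ | ⟨T, p⟩, rfl⟩ := Quot.exists_rep p
  · exact ⟨y.1, by change 1 / 4 < indicator y.1 y.1; rw [indicator_self]; norm_num⟩
  · by_cases ht : (t : ℝ) ≤ 1 / 2
    · refine ⟨a.src, ?_⟩
      change 1 / 4 < edgeWeight a.src a.src a.tgt t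
      rw [edgeWeight, indicator_self, indicator_of_ne a.ne]
      linarith
    · refine ⟨a.tgt, ?_⟩
      change 1 / 4 < edgeWeight a.tgt a.src a.tgt t
      rw [edgeWeight, indicator_self, indicator_of_ne a.ne.symm]
      linarith
  · by_contra! h
    have h0 := h T.x
    have h1 := h T.y
    have h2 := h T.z
    change triangleWeight _ T.x T.y T.z p ≤ _ at h0 h1 h2
    obtain ⟨⟨r, s⟩, hs, hrs, hr⟩ := p
    simp only [triangleWeight, indicator_self] at h0 h1 h2 hs hrs hr
    have n1 := mul_nonneg (sub_nonneg.2 hrs) (indicator_nonneg T.x T.y)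
    have n2 := mul_nonneg hs (indicator_nonneg T.x T.z)
    have n3 := mul_nonneg (sub_nonneg.2 hr) (indicator_nonneg T.y T.x)
    have n4 := mul_nonneg hs (indicator_nonneg T.y T.z)
    have n5 := mul_nonneg (sub_nonneg.2 hr) (indicator_nonneg T.z T.x)
    have n6 := mul_nonneg (sub_nonneg.2 hrs) (indicator_nonneg T.z T.y)
    linarith

/-! ### Contraction of the stars of vertices -/

/-- The closed 2-cell of the triangle `T`, as a map to the CW-complex. -/
def triangleMap (T : E.Triangle) : C(ModelTriangle, E.CW) :=
  ⟨fun p => E.toCW (E.triangleCell T p), E.continuous_toCW.comp (E.continuous_triangleCell T)⟩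

theorem triangleMap_side01 (T : E.Triangle) (t : unitInterval) :
    E.triangleMap T (ModelTriangle.side01 t) = E.edgePath T.ne_zero_xy t :=
  Quot.sound (Glue.side01 T t)

theorem triangleMap_side12 (T : E.Triangle) (t : unitInterval) :
    E.triangleMap T (ModelTriangle.side12 t) = E.edgePath T.ne_zero_yz t :=
  Quot.sound (Glue.side12 T t)

theorem triangleMap_side02 (T : E.Triangle) (t : unitInterval) :
    E.triangleMap T (ModelTriangle.side02 t) = E.edgePath T.ne_zero_xz t :=
  Quot.sound (Glue.side02 T t)

variable {E} in
theorem edgePath_apply_of_eq {x y : C} (h : E.e x y ≠ 0) (hxy : x = y) (t : unitInterval) :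
    E.edgePath h t = E.vertex x := by
  subst hxy
  exact congrArg E.toCW (E.edgeCell_self h t)

/-- The trace on the CW-complex of the push towards `x` of the points of an edge.  Traces are taken
in the space of paths, so that they descend continuously to the quotient that defines the
CW-complex. -/
noncomputable def edgeTrace (x : C) {y z : C} (h : E.e y z ≠ 0) :
    C(unitInterval, C(unitInterval, E.CW)) :=
  ContinuousMap.curry ⟨fun q => E.edgePath h (edgePush x y z q.1 q.2),
    (E.edgePath h).continuous.comp (continuous_edgePush x y z)⟩

/-- The trace on the CW-complex of the push towards `x` of the points of a triangle. -/
noncomputable def triangleTrace (x : C) (T : E.Triangle) :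
    C(ModelTriangle, C(unitInterval, E.CW)) :=
  ContinuousMap.curry ⟨fun q => E.triangleMap T (trianglePush x T.x T.y T.z q.1 q.2),
    (E.triangleMap T).continuous.comp (continuous_trianglePush x T.x T.y T.z)⟩

/-- The trace on the CW-complex of the push towards `x` of a point of a closed cell. -/
noncomputable def cellTrace (x : C) : E.Cells → C(unitInterval, E.CW)
  | Sum.inl y => ContinuousMap.const _ (E.vertex y.1)
  | Sum.inr (Sum.inl a) => E.edgeTrace x a.1.ne_zero a.2
  | Sum.inr (Sum.inr T) => E.triangleTrace x T.1 T.2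

theorem cellTrace_edgeCell (x : C) {y z : C} (h : E.e y z ≠ 0) (t : unitInterval) :
    E.cellTrace x (E.edgeCell h t) = E.edgeTrace x h t := by
  by_cases hyz : y = z
  · subst hyz
    rw [edgeCell_self]
    ext s
    exact (edgePath_apply_of_eq h rfl _).symm
  · exact congrArg (E.cellTrace x) (edgeCell_edge ⟨y, z, hyz, h⟩ t)

/-- The trace of the push towards `x` of a point of the CW-complex. -/
noncomputable def trace (x : C) : E.CW → C(unitInterval, E.CW) :=
  Quot.lift (E.cellTrace x) (by
    rintro _ _ (a | a | ⟨T, t⟩ | ⟨T, t⟩ | ⟨T, t⟩)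
    · rw [cellTrace_edgeCell]
      ext s
      change E.edgePath _ (edgePush x a.src a.tgt 0 s) = E.vertex a.src
      rw [edgePush_left, Path.source]
    · rw [cellTrace_edgeCell]
      ext s
      change E.edgePath _ (edgePush x a.src a.tgt 1 s) = E.vertex a.tgt
      rw [edgePush_right, Path.target]
    · rw [cellTrace_edgeCell]
      ext s
      change E.triangleMap T (trianglePush x T.x T.y T.z _ s) = _
      rw [trianglePush_side01]
      exact E.triangleMap_side01 T _
    · rw [cellTrace_edgeCell]
      ext s
      change E.triangleMap T (trianglePush x T.x T.y T.z _ s) = _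
      rw [trianglePush_side12]
      exact E.triangleMap_side12 T _
    · rw [cellTrace_edgeCell]
      ext s
      change E.triangleMap T (trianglePush x T.x T.y T.z _ s) = _
      rw [trianglePush_side02]
      exact E.triangleMap_side02 T _)

theorem continuous_trace (x : C) : Continuous (E.trace x) := by
  refine continuous_quot_lift _ ?_
  exact continuous_sum_dom.2 ⟨continuous_sigma fun y =>
      (continuous_const : Continuous fun _ : Unit => ContinuousMap.const _ (E.vertex y)),
    continuous_sum_dom.2 ⟨continuous_sigma fun a => (E.edgeTrace x a.ne_zero).continuous,
      continuous_sigma fun T => (E.triangleTrace x T).continuous⟩⟩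

theorem trace_vertex (x y : C) (s : unitInterval) : E.trace x (E.vertex y) s = E.vertex y := rfl

theorem trace_edgePath (x : C) {y z : C} (h : E.e y z ≠ 0) (t s : unitInterval) :
    E.trace x (E.edgePath h t) s = E.edgePath h (edgePush x y z t s) :=
  congrArg (fun γ : C(unitInterval, E.CW) => γ s) (E.cellTrace_edgeCell x h t)

theorem trace_triangleMap (x : C) (T : E.Triangle) (p : ModelTriangle) (s : unitInterval) :
    E.trace x (E.triangleMap T p) s = E.triangleMap T (trianglePush x T.x T.y T.z p s) := rfl

variable {E} in
/-- Every point of the CW-complex is a vertex, a point of an edge or a point of a triangle. -/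
theorem CW_cases {P : E.CW → Prop} (vertex : ∀ x, P (E.vertex x))
    (edge : ∀ (a : E.Edge) (t : unitInterval), P (E.edgePath a.ne_zero t))
    (triangle : ∀ (T : E.Triangle) (p : ModelTriangle), P (E.triangleMap T p)) (p : E.CW) :
    P p := by
  obtain ⟨y | ⟨a, t⟩ | ⟨T, p⟩, rfl⟩ := Quot.exists_rep p
  · exact vertex y.1
  · have h := edge a t
    rwa [show E.edgePath a.ne_zero t = E.toCW (Sum.inr (Sum.inl ⟨a, t⟩)) from
      congrArg E.toCW (edgeCell_edge a t)] at h
  · exact triangle T p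

theorem trace_zero (x : C) (p : E.CW) : E.trace x p 0 = p := by
  induction p using CW_cases with
  | vertex y => rfl
  | edge a t => rw [trace_edgePath, edgePush_zero]
  | triangle T p => rw [trace_triangleMap, trianglePush_zero]

theorem weight_vertex (x y : C) : E.weight x (E.vertex y) = indicator x y := rfl

theorem weight_edgePath (x : C) {y z : C} (h : E.e y z ≠ 0) (t : unitInterval) :
    E.weight x (E.edgePath h t) = edgeWeight x y z t := E.cellWeight_edgeCell x h t

theorem weight_triangleMap (x : C) (T : E.Triangle) (p : ModelTriangle) :
    E.weight x (E.triangleMap T p) = triangleWeight x T.x T.y T.z p := rfl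

/-- The push towards `x` contracts to `x` the points of weight at least `1 / 4`. -/
theorem trace_one {x : C} {p : E.CW} (h : 1 / 4 < E.weight x p) : E.trace x p 1 = E.vertex x := by
  induction p using CW_cases with
  | vertex y =>
    rw [weight_vertex] at h
    by_cases hxy : x = y
    · rw [hxy, trace_vertex]
    · rw [indicator_of_ne hxy] at h
      norm_num at h
  | edge a t =>
    rw [weight_edgePath] at h
    rw [trace_edgePath]
    obtain ⟨h1, h2⟩ | ⟨h1, h2⟩ := edgePush_one a.ne h
    · rw [h2, Path.source, h1]
    · rw [h2, Path.target, h1]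
  | triangle T p =>
    rw [weight_triangleMap] at h
    rw [trace_triangleMap]
    obtain ⟨h1, h2⟩ | ⟨h1, h2⟩ | ⟨h1, h2⟩ | ⟨h1, h3, t, h2⟩ := trianglePush_one T.ne_xy T.ne_yz h
    · rw [h2, triangleMap_side01, Path.source, h1]
    · rw [h2, triangleMap_side01, Path.target, h1]
    · rw [h2, triangleMap_side12, Path.target, h1]
    · rw [h2, triangleMap_side02, edgePath_apply_of_eq _ h3, h1]

/-- The push towards `x`, as a homotopy from the identity of the CW-complex. -/
noncomputable def pushHomotopy (x : C) :
    (ContinuousMap.id E.CW).Homotopy ⟨fun p => E.trace x p 1,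
      (continuous_eval_const 1).comp (E.continuous_trace x)⟩ where
  toFun q := E.trace x q.2 q.1
  continuous_toFun := by
    have h := (ContinuousMap.uncurry ⟨E.trace x, E.continuous_trace x⟩).continuous
    exact h.comp continuous_swap
  map_zero_left p := E.trace_zero x p
  map_one_left _ := rfl

/-! ### Characters which are coboundaries on the 1-cells -/

section Coboundary

variable {E} {A : Type*} [AddCommGroup A] (F : PathCharacter E.CW A) {l : C → A}

/-- The potential on the vertices extends to a point of the CW-complex, consistently with all the
pushes that contract it to a vertex: these pushes take place in one closed cell, which is simply
connected. -/
theorem exists_value_of_coboundary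
    (hF : ∀ (x y : C) (h : E.e x y ≠ 0), F.eval (E.edgePath h) = l y - l x) (p : E.CW) :
    ∃ a : A, ∀ x, 1 / 4 < E.weight x p → F.eval ((E.pushHomotopy x).evalAt p) = l x - a := by
  induction p using CW_cases with
  | vertex y =>
    refine ⟨l y, fun x hx => ?_⟩
    obtain rfl : x = y := by
      by_contra hxy
      rw [weight_vertex, indicator_of_ne hxy] at hx
      norm_num at hx
    rw [sub_self]
    exact F.eval_eq_zero_of_const (E.vertex x) fun s => rfl
  | edge a t =>
    have : ContractibleSpace unitInterval := (convex_Icc (0 : ℝ) 1).contractibleSpace ⟨0, by simp⟩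
    obtain ⟨P, hP⟩ := (F.comap (E.edgePath a.ne_zero).toContinuousMap).exists_potential
    have h01 : l a.tgt - l a.src = P 1 - P 0 := by
      rw [← hF _ _ a.ne_zero, ← hP (p := 0) (q := 1) ⟨ContinuousMap.id _, rfl, rfl⟩]
      exact F.eval_congr fun s => rfl
    refine ⟨l a.src - P 0 + P t, fun x hx => ?_⟩
    let δ : Path t (edgePush x a.src a.tgt t 1) :=
      { toFun := edgePush x a.src a.tgt t
        continuous_toFun := (continuous_edgePush x a.src a.tgt).comp (.prodMk_right t)
        source' := edgePush_zero x _ _ t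
        target' := rfl }
    have hδ : F.eval ((E.pushHomotopy x).evalAt (E.edgePath a.ne_zero t)) =
        P (edgePush x a.src a.tgt t 1) - P t := by
      rw [← hP δ]
      exact F.eval_congr fun s => E.trace_edgePath x a.ne_zero t s
    rw [hδ]
    rw [weight_edgePath] at hx
    obtain ⟨rfl, h⟩ | ⟨rfl, h⟩ := edgePush_one a.ne hx
    · rw [h]; abel
    · rw [h, sub_eq_sub_iff_add_eq_add.1 h01 |> eq_sub_of_add_eq]; abel
  | triangle T p =>
    obtain ⟨P, hP⟩ := (F.comap (E.triangleMap T)).exists_potential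
    have hP' : ∀ {q r : ModelTriangle} (δ : Path q r) {y z : E.CW} (γ : Path y z),
        (∀ s, E.triangleMap T (δ s) = γ s) → P r - P q = F.eval γ := by
      intro q r δ y z γ h
      rw [← hP δ]
      exact F.eval_congr (γ := δ.map (E.triangleMap T).continuous) h
    have h01 : P (ModelTriangle.side01 1) - P (ModelTriangle.side01 0) = l T.y - l T.x := by
      rw [← hF _ _ T.ne_zero_xy]
      refine hP' ⟨⟨_, continuous_side01⟩, rfl, rfl⟩ _
        fun s => E.triangleMap_side01 T s
    have h12 : P (ModelTriangle.side12 1) - P (ModelTriangle.side01 1) = l T.z - l T.y := by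
      rw [← hF _ _ T.ne_zero_yz]
      refine hP' ⟨⟨_, continuous_side12⟩, rfl, rfl⟩ _
        fun s => E.triangleMap_side12 T s
    -- If the first and the last vertex agree, the side between them is collapsed.
    have h02 : T.x = T.z → ∀ t : unitInterval,
        P (ModelTriangle.side02 t) = P (ModelTriangle.side01 0) := fun hxz t => by
      have := hP' (r := ModelTriangle.side02 t) (q := ModelTriangle.side01 0)
        ⟨⟨fun s => ModelTriangle.side02 (s * t), continuous_side02.comp (continuous_mul_const t)⟩,
          congrArg ModelTriangle.side02 (zero_mul t),
          congrArg ModelTriangle.side02 (one_mul t)⟩ (Path.refl (E.vertex T.x))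
        fun s => by
          refine (E.triangleMap_side02 T (s * t)).trans ?_
          rw [edgePath_apply_of_eq _ hxz, Path.refl_apply]
      rwa [F.eval_refl, sub_eq_zero] at this
    refine ⟨l T.x - P (ModelTriangle.side01 0) + P p, fun x hx => ?_⟩
    have hδ : P (trianglePush x T.x T.y T.z p 1) - P p =
        F.eval ((E.pushHomotopy x).evalAt (E.triangleMap T p)) :=
      hP' ⟨⟨trianglePush x T.x T.y T.z p,
        (continuous_trianglePush x T.x T.y T.z).comp (.prodMk_right p)⟩,
        trianglePush_zero x _ _ _ p, rfl⟩ _ fun s => rfl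
    rw [← hδ]
    rw [weight_triangleMap] at hx
    obtain ⟨rfl, h⟩ | ⟨rfl, h⟩ | ⟨rfl, h⟩ | ⟨rfl, h', t, h⟩ :=
      trianglePush_one T.ne_xy T.ne_yz hx
    · rw [h]; abel
    · rw [h, sub_eq_iff_eq_add.1 h01]; abel
    · rw [h, sub_eq_iff_eq_add.1 h12, sub_eq_iff_eq_add.1 h01]; abel
    · rw [h, h02 h' t]; abel

/-- A character which is a coboundary on the 1-cells is a coboundary; this is the additive form
of the fact that the fundamental group is generated by edge loops. -/
theorem eval_loop_eq_zero_of_coboundary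
    (hF : ∀ (x y : C) (h : E.e x y ≠ 0), F.eval (E.edgePath h) = l y - l x)
    {p : E.CW} (γ : Path p p) : F.eval γ = 0 := by
  choose Λ hΛ using exists_value_of_coboundary F hF
  rw [F.eval_eq_sub_of_local Λ (fun p => ?_) γ, sub_self]
  -- On the points contracted to `x`, the push deforms a path to a constant one.
  obtain ⟨x, hx⟩ := E.exists_weight_gt p
  refine ⟨{q | 1 / 4 < E.weight x q},
    (isOpen_lt continuous_const (E.continuous_weight x)).mem_nhds hx, fun {q r} δ hδ => ?_⟩
  have h := F.eval_add_eval_evalAt (E.pushHomotopy x) δ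
  have hq : 1 / 4 < E.weight x q := by simpa using hδ 0
  have hr : 1 / 4 < E.weight x r := by simpa using hδ 1
  have hgδ := F.eval_eq_zero_of_const (γ := δ.map (ContinuousMap.continuous
    ⟨fun p => E.trace x p 1, (continuous_eval_const 1).comp (E.continuous_trace x)⟩))
    (E.vertex x) fun t => E.trace_one (hδ t)
  rw [hΛ q x hq, hΛ r x hr, hgδ, add_zero, ← eq_sub_iff_add_eq] at h
  rw [h]
  abel

end Coboundary

/-! ### Characters with prescribed values on the 1-cells -/

section Cocycle

variable {A : Type*} [AddCommGroup A] (c : C → C → A)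

open Classical in
/-- When `c` is a cocycle, a potential on the vertices of a closed cell whose differences along the
edges are the values of `c`.  The value at an object which is not a vertex of the cell is
irrelevant. -/
noncomputable def cellPotential : E.Cells → C → A
  | Sum.inl _, _ => 0
  | Sum.inr (Sum.inl a), i => if i = a.1.src then 0 else c a.1.src a.1.tgt
  | Sum.inr (Sum.inr T), i =>
    if i = T.1.x then 0 else if i = T.1.y then c T.1.x T.1.y else c T.1.x T.1.z

open Classical in
/-- The difference of the potentials of the vertices `j` and `i` at the points of the cells in the
open stars of both, extended by zero. -/
noncomputable def cellTransition (i j : C) (p : E.Cells) : A :=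
  if 0 < E.cellWeight i p ∧ 0 < E.cellWeight j p then
    E.cellPotential c p j - E.cellPotential c p i else 0

variable {c}

theorem cellTransition_congr {i j : C} {p q : E.Cells}
    (hw : ∀ x, E.cellWeight x p = E.cellWeight x q)
    (h : 0 < E.cellWeight i q → 0 < E.cellWeight j q →
      E.cellPotential c p j - E.cellPotential c p i =
        E.cellPotential c q j - E.cellPotential c q i) :
    E.cellTransition c i j p = E.cellTransition c i j q := by
  unfold cellTransition
  rw [hw i, hw j]
  split_ifs with h'
  · exact h h'.1 h'.2
  · rfl

theorem cellPotential_edgeCell_src {y z : C} (h : E.e y z ≠ 0) (t : unitInterval) :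
    E.cellPotential c (E.edgeCell h t) y = 0 := by
  by_cases hyz : y = z
  · subst hyz
    rw [edgeCell_self]
    rfl
  · rw [show E.edgeCell h t = Sum.inr (Sum.inl ⟨⟨y, z, hyz, h⟩, t⟩) from
      edgeCell_edge ⟨y, z, hyz, h⟩ t]
    exact if_pos rfl

variable (hc : ∀ x y z : C, E.e x y ≫ E.e y z ≠ 0 → c x z = c x y + c y z)
include hc

theorem cocycle_self {x : C} (h : E.e x x ≠ 0) : c x x = 0 := by
  refine left_eq_add.1 (hc x x x ?_)
  rw [E.e_self] at h ⊢
  rwa [Category.id_comp]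

theorem cellPotential_edgeCell_tgt {y z : C} (h : E.e y z ≠ 0) (t : unitInterval) :
    E.cellPotential c (E.edgeCell h t) z = c y z := by
  by_cases hyz : y = z
  · subst hyz
    rw [cellPotential_edgeCell_src, E.cocycle_self hc h]
  · rw [show E.edgeCell h t = Sum.inr (Sum.inl ⟨⟨y, z, hyz, h⟩, t⟩) from
      edgeCell_edge ⟨y, z, hyz, h⟩ t]
    exact if_neg (Ne.symm hyz)

theorem cellTransition_glue (i j : C) {p q : E.Cells} (h : E.Glue p q) :
    E.cellTransition c i j p = E.cellTransition c i j q := by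
  refine E.cellTransition_congr (fun x => congrArg (E.weight x) (Quot.sound h)) fun hi hj => ?_
  have tri_x : ∀ (T : E.Triangle) t, E.cellPotential c (E.triangleCell T t) T.x = 0 :=
    fun T t => by simp [triangleCell, cellPotential]
  have tri_y : ∀ (T : E.Triangle) t, E.cellPotential c (E.triangleCell T t) T.y = c T.x T.y :=
    fun T t => by simp [triangleCell, cellPotential, T.ne_xy.symm]
  have tri_z : ∀ (T : E.Triangle) t, E.cellPotential c (E.triangleCell T t) T.z = c T.x T.z :=
    fun T t => by
      by_cases h : T.z = T.x
      · have := E.cocycle_self hc (x := T.x) (by have := T.ne_zero_xz; rwa [h] at this)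
        rw [h, tri_x, this]
      · simp [triangleCell, cellPotential, h, T.ne_yz.symm]
  cases h with
  | edge_zero a =>
    obtain rfl := eq_of_indicator_pos hi
    obtain rfl := eq_of_indicator_pos hj
    rw [sub_self, sub_self]
  | edge_one a =>
    obtain rfl := eq_of_indicator_pos hi
    obtain rfl := eq_of_indicator_pos hj
    rw [sub_self, sub_self]
  | side01 T t =>
    rw [cellWeight_edgeCell] at hi hj
    obtain rfl | rfl := eq_or_eq_of_edgeWeight_pos hi <;>
    obtain rfl | rfl := eq_or_eq_of_edgeWeight_pos hj <;>
    simp only [tri_x, tri_y, cellPotential_edgeCell_src, cellPotential_edgeCell_tgt E hc]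
  | side12 T t =>
    have hT := hc _ _ _ T.comp_ne_zero
    rw [cellWeight_edgeCell] at hi hj
    obtain rfl | rfl := eq_or_eq_of_edgeWeight_pos hi <;>
    obtain rfl | rfl := eq_or_eq_of_edgeWeight_pos hj <;>
    simp only [tri_z, tri_y, cellPotential_edgeCell_src, cellPotential_edgeCell_tgt E hc, hT] <;>
    abel
  | side02 T t =>
    rw [cellWeight_edgeCell] at hi hj
    obtain rfl | rfl := eq_or_eq_of_edgeWeight_pos hi <;>
    obtain rfl | rfl := eq_or_eq_of_edgeWeight_pos hj <;>
    simp only [tri_x, tri_z, cellPotential_edgeCell_src, cellPotential_edgeCell_tgt E hc]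

/-- The Čech cocycle of the covering of the CW-complex attached to `c`, with respect to the cover
by the open stars of the vertices. -/
noncomputable def starCocycle : CechCocycle C E.CW A where
  baseSet x := {p | 0 < E.weight x p}
  isOpen_baseSet x := isOpen_lt continuous_const (E.continuous_weight x)
  indexAt p := (E.exists_weight_gt p).choose
  mem_baseSet_at p := lt_trans (by norm_num) (E.exists_weight_gt p).choose_spec
  g i j := Quot.lift (E.cellTransition c i j) fun _ _ h => E.cellTransition_glue hc i j h
  eventually_eq i j p hp := by
    let _ : TopologicalSpace A := ⊥
    have : DiscreteTopology A := ⟨rfl⟩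
    have hpot : Continuous fun q : E.Cells => E.cellPotential c q j - E.cellPotential c q i :=
      continuous_sum_dom.2 ⟨continuous_sigma fun y =>
          (continuous_const : Continuous fun _ : Unit => (0 : A) - 0),
        continuous_sum_dom.2 ⟨continuous_sigma fun a => continuous_const (y :=
            E.cellPotential c (Sum.inr (Sum.inl ⟨a, 0⟩)) j -
              E.cellPotential c (Sum.inr (Sum.inl ⟨a, 0⟩)) i),
          continuous_sigma fun T => continuous_const (y :=
            E.cellPotential c (E.triangleCell T (ModelTriangle.side01 0)) j -
              E.cellPotential c (E.triangleCell T (ModelTriangle.side01 0)) i)⟩⟩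
    have hcell : ∀ q : E.Cells, 0 < E.weight i (E.toCW q) → 0 < E.weight j (E.toCW q) →
        E.cellTransition c i j q = E.cellPotential c q j - E.cellPotential c q i :=
      fun q hi hj => if_pos ⟨hi, hj⟩
    obtain ⟨p, rfl⟩ := Quot.exists_rep p
    have hopen : IsOpen ({q : E.CW | 0 < E.weight i q} ∩ {q | 0 < E.weight j q} ∩
        {q | Quot.lift (E.cellTransition c i j) (fun _ _ h => E.cellTransition_glue hc i j h) q =
          E.cellTransition c i j p}) := by
      refine isQuotientMap_quot_mk.isOpen_preimage.1 ?_
      have h1 : IsOpen (E.toCW ⁻¹' ({q | 0 < E.weight i q} ∩ {q | 0 < E.weight j q}) ∩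
          (fun q => E.cellPotential c q j - E.cellPotential c q i) ⁻¹'
            {E.cellTransition c i j p}) :=
        (((isOpen_lt continuous_const (E.continuous_weight i)).inter
          (isOpen_lt continuous_const (E.continuous_weight j))).preimage E.continuous_toCW).inter
          ((isOpen_discrete _).preimage hpot)
      convert! h1 using 1
      ext q
      simp only [Set.mem_preimage, Set.mem_inter_iff, Set.mem_ofPred_eq, Set.mem_singleton_iff]
      refine and_congr_right fun hq => ?_
      rw [← hcell q hq.1 hq.2]
      rfl
    filter_upwards [hopen.mem_nhds ⟨hp, rfl⟩] with q hq
    exact hq.2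
  g_add i j l p hp := by
    obtain ⟨p, rfl⟩ := Quot.exists_rep p
    obtain ⟨⟨hi, hj⟩, hl⟩ := hp
    have h1 : E.cellTransition c i j p = _ := if_pos ⟨hi, hj⟩
    have h2 : E.cellTransition c j l p = _ := if_pos ⟨hj, hl⟩
    have h3 : E.cellTransition c i l p = _ := if_pos ⟨hi, hl⟩
    change E.cellTransition c i j p + E.cellTransition c j l p = E.cellTransition c i l p
    rw [h1, h2, h3]
    abel

/-- A function on the 1-cells satisfying the cocycle condition on the 2-cells comes from a
character of the fundamental groupoid: the monodromy of the corresponding covering. -/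
theorem exists_pathCharacter_of_cocycle :
    ∃ F : PathCharacter E.CW A, ∀ (x y : C) (h : E.e x y ≠ 0), F.eval (E.edgePath h) = c x y := by
  let Z := E.starCocycle hc
  obtain ⟨F, hF⟩ := Z.exists_pathCharacter
  refine ⟨F, fun x y h => ?_⟩
  by_cases hxy : x = y
  · subst hxy
    rw [E.cocycle_self hc h]
    exact F.eval_eq_zero_of_const (E.vertex x) fun t => edgePath_apply_of_eq h rfl t
  let γ := E.edgePath h
  -- In the chart at `x` the lift is constant with value `0`; in the chart at `y` it is constant
  -- with value `c x y`.
  let f : unitInterval → A := fun t =>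
    if t < 1 then Z.g x (Z.indexAt (γ t)) (γ t) else c x y + Z.g y (Z.indexAt (γ t)) (γ t)
  have hwx : ∀ t : unitInterval, t < 1 → γ t ∈ Z.baseSet x := fun t ht => by
    change 0 < E.weight x (γ t)
    rw [weight_edgePath, edgeWeight, indicator_self, indicator_of_ne hxy, mul_zero, add_zero,
      mul_one]
    exact sub_pos.2 ht
  have hwy : ∀ t : unitInterval, 0 < t → γ t ∈ Z.baseSet y := fun t ht => by
    change 0 < E.weight y (γ t)
    rw [weight_edgePath, edgeWeight, indicator_self, indicator_of_ne (Ne.symm hxy), mul_zero,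
      zero_add, mul_one]
    exact ht
  have hg : ∀ t : unitInterval, 0 < t → t < 1 → Z.g x y (γ t) = c x y := fun t h0 h1 => by
    change E.cellTransition c x y (E.edgeCell h t) = c x y
    have : E.cellTransition c x y (E.edgeCell h t) = _ := if_pos ⟨hwx t h1, hwy t h0⟩
    rw [this, cellPotential_edgeCell_src, E.cellPotential_edgeCell_tgt hc, sub_zero]
  have hnhds : ∀ t₀, ∀ᶠ t in nhds t₀, γ t ∈ Z.baseSet (Z.indexAt (γ t₀)) := fun t₀ =>
    γ.continuous.continuousAt ((Z.isOpen_baseSet _).mem_nhds (Z.mem_baseSet_at _))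
  have hf : Z.IsPrimitive γ f := fun t₀ => by
    rcases lt_or_eq_of_le (unitInterval.le_one' (t := t₀)) with h1 | rfl
    · filter_upwards [hnhds t₀, eventually_lt_nhds h1, γ.continuous.continuousAt.eventually
        (Z.eventually_eq x (Z.indexAt (γ t₀)) (γ t₀) ⟨hwx t₀ h1, Z.mem_baseSet_at _⟩)]
        with t ht ht1 hgt
      simp only [f, if_pos h1, if_pos ht1]
      rw [Z.g_add _ _ _ _ ⟨⟨hwx t ht1, Z.mem_baseSet_at _⟩, ht⟩, hgt]
    · filter_upwards [hnhds 1, eventually_gt_nhds zero_lt_one, γ.continuous.continuousAt.eventually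
        (Z.eventually_eq y (Z.indexAt (γ 1)) (γ 1) ⟨hwy 1 zero_lt_one, Z.mem_baseSet_at _⟩)]
        with t ht ht0 hgt
      simp only [f, lt_irrefl, if_false]
      rw [← hgt]
      split_ifs with ht1
      · rw [Z.g_add _ _ _ _ ⟨⟨hwx t ht1, Z.mem_baseSet_at _⟩, ht⟩, ← hg t ht0 ht1,
          Z.g_add _ _ _ _ ⟨⟨hwx t ht1, hwy t ht0⟩, ht⟩]
      · rw [add_assoc, Z.g_add _ _ _ _ ⟨⟨hwy t ht0, Z.mem_baseSet_at _⟩, ht⟩]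
  -- The transition functions vanish at the vertices, as these lie in the star of one vertex only.
  have hv : ∀ i j z : C, Z.g i j (E.vertex z) = 0 := fun i j z => by
    change E.cellTransition c i j (E.vertexCell z) = 0
    unfold cellTransition
    split_ifs
    · exact sub_self 0
    · rfl
  rw [hF γ f hf]
  simp only [f, lt_irrefl, if_false, zero_lt_one, if_true]
  rw [γ.source, γ.target, hv, hv, add_zero, sub_zero]

end Cocycle

/-! ### The Hurewicz morphism -/

theorem pathConnectedSpace_CW {c₀ : C} (conn : ∀ x : C, CatWalk c₀ x) :
    PathConnectedSpace E.CW := by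
  have h : ∀ p : E.CW, Joined (E.vertex c₀) p := fun p => by
    obtain ⟨x, hx⟩ := E.exists_weight_gt p
    have hp : Joined p (E.trace x p 1) := ⟨(E.pushHomotopy x).evalAt p⟩
    rw [E.trace_one hx] at hp
    exact Joined.trans ⟨E.walkPath (conn x)⟩ hp.symm
  exact ⟨⟨E.vertex c₀⟩, fun p q => (h p).symm.trans (h q)⟩

/-- A character of the fundamental group whose values on the degrees of the chosen morphisms are
a coboundary vanishes. -/
theorem hom_eq_zero_of_coboundary {A : Type*} [AddCommGroup A] {c₀ : C}
    (conn : ∀ x : C, CatWalk c₀ x) (χ : Additive (E.pi1 c₀) →+ A) (l : C → A)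
    (hχ : ∀ (x y : C) (h : E.e x y ≠ 0),
      χ (Additive.ofMul (E.loopDeg conn h)) = l y - l x) : χ = 0 := by
  have := E.pathConnectedSpace_CW conn
  obtain ⟨F, hF⟩ := PathCharacter.exists_eval_eq χ
  have hedge : ∀ (x y : C) (h : E.e x y ≠ 0), F.eval (E.edgePath h) =
      (l y + F.eval (E.walkPath (conn y))) - (l x + F.eval (E.walkPath (conn x))) :=
    fun x y h => by
      have h1 := (hF _).trans (hχ x y h)
      rw [F.eval_trans, F.eval_trans, F.eval_symm, ← sub_eq_add_neg, sub_eq_iff_eq_add] at h1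
      rw [eq_sub_iff_add_eq', add_assoc, h1]
      abel
  ext γ
  obtain ⟨δ, rfl⟩ := Path.Homotopic.Quotient.mk_surjective γ
  exact (hF δ).symm.trans (eval_loop_eq_zero_of_coboundary F hedge δ)

variable {k : Type w} [Field k] [Linear k C] (hS : IsSchurian k C)

theorem mem_universalGrading {c₀ : C} (conn : ∀ x : C, CatWalk c₀ x) {x y : C}
    (h : E.e x y ≠ 0) (f : x ⟶ y) :
    f ∈ (E.universalGrading k hS conn).comp (E.loopDeg conn h) x y := by
  obtain ⟨a, rfl⟩ := E.exists_smul k hS h f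
  exact Submodule.smul_mem _ _ (Submodule.subset_span ⟨h, rfl, rfl⟩)

/-- The Eulerian derivation of `χ` for the universal grading, on non-zero morphisms. -/
theorem eulerian_apply {c₀ : C} (conn : ∀ x : C, CatWalk c₀ x)
    (χ : Additive (E.pi1 c₀) →+ k) {x y : C} (h : E.e x y ≠ 0) (f : x ⟶ y) :
    ((E.universalGrading k hS conn).eulerian χ).1 x y f =
      χ (Additive.ofMul (E.loopDeg conn h)) • f :=
  (E.universalGrading k hS conn).eulerianMap_of_mem χ (E.mem_universalGrading hS conn h f)

include E hS in
theorem exists_endomorphism_scalars (a : ∀ x : C, x ⟶ x) : ∃ l : C → k, ∀ x, a x = l x • 𝟙 x := by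
  have h : ∀ x, ∃ m : k, a x = m • 𝟙 x := fun x => by
    by_cases hx : E.e x x = 0
    · refine ⟨0, ?_⟩
      rw [zero_smul]
      by_contra ha
      exact E.e_ne_zero (a x) ha hx
    · rw [← E.e_self]
      exact E.exists_smul k hS hx (a x)
  choose l hl using h
  exact ⟨l, hl⟩

theorem innerDerivation_smul_id (l : C → k) {x y : C} (f : x ⟶ y) :
    (innerDerivation k C fun x => l x • 𝟙 x).1 x y f = (l y - l x) • f := by
  change f ≫ (l y • 𝟙 y) - (l x • 𝟙 x) ≫ f = _
  rw [Linear.comp_smul, Linear.smul_comp, Category.comp_id, Category.id_comp, sub_smul]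

include hS in
/-- A derivation of a Schurian category multiplies the chosen morphisms by a cocycle. -/
theorem exists_cocycle_of_derivation (D : catDerivations k C) :
    ∃ c : C → C → k, (∀ (x y : C) (_ : E.e x y ≠ 0) (f : x ⟶ y), D.1 x y f = c x y • f) ∧
      ∀ x y z : C, E.e x y ≫ E.e y z ≠ 0 → c x z = c x y + c y z := by
  have h : ∀ x y : C, ∃ m : k, E.e x y ≠ 0 → ∀ f : x ⟶ y, D.1 x y f = m • f := fun x y => by
    by_cases hxy : E.e x y = 0
    · exact ⟨0, fun h => absurd hxy h⟩
    · obtain ⟨m, hm⟩ := E.exists_smul k hS hxy (D.1 x y (E.e x y))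
      refine ⟨m, fun _ f => ?_⟩
      obtain ⟨b, rfl⟩ := E.exists_smul k hS hxy f
      rw [map_smul, hm, smul_comm]
  choose c hc using h
  refine ⟨c, hc, fun x y z hxyz => ?_⟩
  have hxy : E.e x y ≠ 0 := fun h => hxyz (by rw [h, Limits.zero_comp])
  have hyz : E.e y z ≠ 0 := fun h => hxyz (by rw [h, Limits.comp_zero])
  have hD := D.2 x y z (E.e x y) (E.e y z)
  rw [hc x z (E.e_ne_zero _ hxyz), hc x y hxy, hc y z hyz, Linear.comp_smul, Linear.smul_comp,
    ← add_smul, add_comm (c y z)] at hD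
  exact smul_left_injective k hxyz hD

theorem hurewicz_injective {c₀ : C} (conn : ∀ x : C, CatWalk c₀ x) :
    Function.Injective (E.universalGrading k hS conn).hurewicz := by
  rw [injective_iff_map_eq_zero]
  intro χ hχ
  obtain ⟨a, ha⟩ := (Submodule.Quotient.mk_eq_zero _).1 hχ
  obtain ⟨l, hl⟩ := E.exists_endomorphism_scalars hS a
  obtain rfl : a = fun x => l x • 𝟙 x := funext hl
  refine E.hom_eq_zero_of_coboundary conn χ l fun x y h => ?_
  refine smul_left_injective k h ?_
  change χ _ • E.e x y = (l y - l x) • E.e x y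
  rw [← E.eulerian_apply hS conn χ h, ← innerDerivation_smul_id, ha]
  rfl

theorem hurewicz_surjective {c₀ : C} (conn : ∀ x : C, CatWalk c₀ x) :
    Function.Surjective (E.universalGrading k hS conn).hurewicz := by
  intro D
  obtain ⟨D, rfl⟩ := Submodule.Quotient.mk_surjective _ D
  obtain ⟨c, hD, hc⟩ := E.exists_cocycle_of_derivation hS D
  obtain ⟨F, hF⟩ := E.exists_pathCharacter_of_cocycle hc
  -- The connectors change the cocycle `c` by a coboundary, that is `D` by an inner derivation.
  refine ⟨F.restrict (E.vertex c₀), (Submodule.Quotient.eq _).2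
    ⟨fun x => (-F.eval (E.walkPath (conn x))) • 𝟙 x, Subtype.ext ?_⟩⟩
  funext x y
  ext f
  by_cases h : E.e x y = 0
  · obtain rfl : f = 0 := by
      by_contra hf
      exact E.e_ne_zero f hf h
    simp only [map_zero]
  · refine (innerDerivation_smul_id _ f).trans ?_
    change _ = ((E.universalGrading k hS conn).eulerian (F.restrict (E.vertex c₀))).1 x y f -
      D.1 x y f
    rw [E.eulerian_apply hS conn _ h, hD x y h, ← sub_smul]
    congr 1
    have hdeg : F.restrict (E.vertex c₀) (Additive.ofMul (E.loopDeg conn h)) =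
        F.eval (E.walkPath (conn x)) + c x y - F.eval (E.walkPath (conn y)) := by
      refine (F.restrict_mk _ _).trans ?_
      rw [F.eval_trans, F.eval_trans, F.eval_symm, hF, ← sub_eq_add_neg]
    rw [hdeg]
    abel

end MorphismChoice

theorem mainTheorem2 {k : Type w} [Field k] {C : Type u} [Category.{v} C] [Preadditive C]
    [Linear k C] (hS : IsSchurian k C) (hC : CatConnected C)
    (E : MorphismChoice C) (c₀ : C) (conn : ∀ x : C, CatWalk c₀ x) :
    Function.Bijective (E.universalGrading k hS conn).hurewicz ∧
      ∀ χ : Additive (E.pi1 c₀) →+ k, ∃ D : catDerivations k C,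
        (E.universalGrading k hS conn).hurewicz χ = Submodule.Quotient.mk D ∧
        ∀ (x y : C) (f : x ⟶ y) (hf : f ≠ 0),
          D.1 x y f = χ (Additive.ofMul (E.loopDeg conn (E.e_ne_zero f hf))) • f :=
  ⟨⟨E.hurewicz_injective hS conn, E.hurewicz_surjective hS conn⟩,
    fun χ => ⟨(E.universalGrading k hS conn).eulerian χ, rfl,
      fun _ _ f hf => E.eulerian_apply hS conn χ (E.e_ne_zero f hf) f⟩⟩
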